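/- Let $d\in\mathbb N$, let $B=(B(t):t\ge 0)$ be a standard $d$-dimensional Brownian motion on a probability space $(\Omega,\mathcal F,P)$, let $A\in\mathbb R^{d\times d}$ with $AA^T$ positive definite, let $v\in\mathbb R^d$, and let $R=I-Q$, where $Q\in\mathbb R^{d\times d}$ has non-negative entries and spectral radius less than $1$. Vector inequalities are understood componentwise. Assume $R^{-1}v<0$, and let $z\in\mathbb R^d$ be such that $v<z$ and $R^{-1}z<0$. Put $$X(t)=vt+AB(t),\qquad Z(t)=X(t)-zt\qquad(t\ge 0),$$ and let $X^{\leftarrow}(t)=-X(-t)$ and $Z^{\leftarrow}(t)=-Z(-t)$ for $t\le 0$. For a matrix $M$, a time $T\le 0$, a continuous path $x:[T,0]\to\mathbb R^d$ and a vector $y_0\ge 0$, a solution of the Skorokhod problem on $[T,0]$ with reflection matrix $M$, input $x$ and initial value $y_0$ at time $T$ is a continuous path $y\ge 0$ on $[T,0]$ with $y(T)=y_0$ and $$y(t)=y_0+x(t)-x(T)+M\,L(t),\qquad T\le t\le 0,$$ for some right-continuous $L$ with non-decreasing coordinates such that $L(T)=0$ and $\int_{(T,0]} y_j\,dL_j=0$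 for every $j$. For a matrix $M$, a process $(W(t):t\ge0)$ and a process $(x(t):t\le0)$, call a process $(Y(t):t\le 0)$ a stationary version, driven by $x$, of the process reflected according to $M$ with input $W$ if (a) for every $T\le 0$ the process $(x(T+s)-x(T):0\le s\le -T)$ has the same finite-dimensional distributions as $(W(s):0\le s\le -T)$; (b) almost surely, for every $T\le 0$, $Y$ solves on $[T,0]$ the Skorokhod problem with reflection matrix $M$ and input $x$ (with its own initial value $Y(T)$); (c) for every $T\le 0$, $(Y(s):s\le T)$ is independent of $(x(t)-x(T):T\le t\le 0)$; and (d) the finite-dimensional distributions of $Y$ are invariant under time shifts. Let the dominating process be $Y^+(s)=\sup_{r\le s}\big(Z^{\leftarrow}(s)-Z^{\leftarrow}(r)\big)$, $s\le 0$, the supremum being taken componentwise. Then: 1. Almost surely, for every $T\le 0$ the Skorokhod problem on $[T,0]$ with reflection matrix $I$, input $Z^{\leftarrow}$ and initial value $0$ at time $T$ has a unique solution $Y^{+}_{T}$, and $Y^+(t)=\lim_{T\to-\infty}Y^+_T(t)$ for all $t\le 0$. The process $Y^+$ is a stationary version, driven by $Z^{\leftarrow}$, of the process reflected according to $I$ with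 input $Z$. 2. On the same probability space there is a stationary version $(Y^*(t):t\le 0)$, driven by $X^{\leftarrow}$, of the process reflected according to $R$ with input $X$ (that is, of the reflected Brownian motion $Y$), such that almost surely $$R^{-1}Y^*(t)\le R^{-1}Y^+(t)\qquad\text{for all } t\le 0.$$ 3. Almost surely, for every $T\le 0$ the Skorokhod problem on $[T,0]$ with reflection matrix $R$, input $X^{\leftarrow}$ and initial value $Y^+(T)$ at time $T$ has a unique solution $Y_T$; for every $t\le0$, $R^{-1}Y_T(t)$ decreases as $T\to-\infty$ through $T\le t$, i.e. $R^{-1}Y_S(t)\le R^{-1}Y_T(t)$ whenever $S\le T\le t\le 0$; and $Y^*(t)=\lim_{T\to-\infty}Y_T(t)$ for all $t\le 0$. -/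

import Mathlib

open MeasureTheory ProbabilityTheory Set Filter Topology
open scoped NNReal ENNReal Matrix

namespace ReflectedBM

variable {d : ℕ} {Ω : Type*} [MeasurableSpace Ω]

/-- `R` is an M-matrix: `R = I - Q`, where `Q` has non-negative entries and spectral radius
(taken over the complex eigenvalues) strictly less than one. -/
def IsMMatrix (R : Matrix (Fin d) (Fin d) ℝ) : Prop :=
  ∃ Q : Matrix (Fin d) (Fin d) ℝ, (∀ i j, 0 ≤ Q i j) ∧
    spectralRadius ℂ (Q.map (algebraMap ℝ ℂ)) < 1 ∧ R = 1 - Q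

/-- A standard `d`-dimensional Brownian motion on `[0, ∞)`: the coordinates are independent
standard real Brownian motions (with almost surely continuous paths). -/
structure IsStandardBM (B : Fin d → ℝ≥0 → Ω → ℝ) (P : Measure Ω) : Prop where
  brownian : ∀ i, IsBrownianReal (B i) P
  indep : iIndepFun (fun i ω t => B i t ω) P

/-- The process `m t + A B(t)`, `t ≥ 0`. -/
noncomputable def driftedBM (m : Fin d → ℝ) (A : Matrix (Fin d) (Fin d) ℝ)
    (B : Fin d → ℝ≥0 → Ω → ℝ) (t : ℝ≥0) (ω : Ω) : Fin d → ℝ :=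
  (t : ℝ) • m + A *ᵥ (fun j => B j t ω)

/-- The time-reversed process `t ↦ -X(-t)`, to be used for `t ≤ 0` only. -/
noncomputable def timeReversal (X : ℝ≥0 → Ω → Fin d → ℝ) (t : ℝ) (ω : Ω) : Fin d → ℝ :=
  -X (Real.toNNReal (-t)) ω

/-- `(y, L)` solves on the time interval `[a, b]` the Skorokhod problem with reflection matrix `R`
and continuous input path `x`:
`y(t) = y(a) + (x(t) - x(a)) + R L(t)`, `y ≥ 0`, every `L_i` is non-decreasing with `L_i(a) = 0`
and `∫ y_i dL_i = 0`. Only the values of `L` on `[a, b]` matter; monotonicity and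
right-continuity of `L_i` are part of the type `StieltjesFunction ℝ`. -/
structure IsSkorokhodSolution (R : Matrix (Fin d) (Fin d) ℝ) (a b : ℝ)
    (x y : ℝ → Fin d → ℝ) (L : Fin d → StieltjesFunction ℝ) : Prop where
  continuousOn : ContinuousOn y (Icc a b)
  equation : ∀ t ∈ Icc a b, y t = y a + (x t - x a) + R *ᵥ (fun i => L i t)
  nonneg : ∀ t ∈ Icc a b, ∀ i, 0 ≤ y t i
  pushing_zero : ∀ i, L i a = 0
  complementarity : ∀ i, ∫⁻ t in Ioc a b, ENNReal.ofReal (y t i) ∂(L i).measure = 0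

/-- `y` is a reflected path on `[a, b]` driven by `x`. -/
def IsReflectedPath (R : Matrix (Fin d) (Fin d) ℝ) (a b : ℝ) (x y : ℝ → Fin d → ℝ) : Prop :=
  ∃ L : Fin d → StieltjesFunction ℝ, IsSkorokhodSolution R a b x y L

/-- `y` is *the* reflected path on `[a, b]` driven by `x` and started from `y₀` at time `a`. -/
def IsUniqueReflectedPath (R : Matrix (Fin d) (Fin d) ℝ) (a b : ℝ) (x : ℝ → Fin d → ℝ)
    (y₀ : Fin d → ℝ) (y : ℝ → Fin d → ℝ) : Prop :=
  IsReflectedPath R a b x y ∧ y a = y₀ ∧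
    ∀ y' : ℝ → Fin d → ℝ, IsReflectedPath R a b x y' → y' a = y₀ → EqOn y' y (Icc a b)

/-- `(Y(t) : t ≤ 0)` is a stationary version, driven by the input `(x(t) : t ≤ 0)`, of the
reflected process with reflection matrix `R` and input `(X(t) : t ≥ 0)`. -/
structure IsStationaryVersion (P : Measure Ω) (R : Matrix (Fin d) (Fin d) ℝ)
    (X : ℝ≥0 → Ω → Fin d → ℝ) (x Y : ℝ → Ω → Fin d → ℝ) : Prop where
  /-- From any time `T ≤ 0` on, the increments of `x` form a copy of `X`. -/
  input_law : ∀ T ≤ (0 : ℝ), ∀ (n : ℕ) (s : Fin n → ℝ≥0), (∀ k, T + (s k : ℝ) ≤ 0) →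
    IdentDistrib (fun ω k => x (T + s k) ω - x T ω) (fun ω k => X (s k) ω) P P
  /-- Almost surely `Y` solves the Skorokhod problem driven by `x` on each `[T, 0]`. -/
  dynamics : ∀ᵐ ω ∂P, ∀ T ≤ (0 : ℝ), IsReflectedPath R T 0 (fun t => x t ω) (fun t => Y t ω)
  /-- The past of `Y` up to time `T` is independent of the increments of `x` after time `T`. -/
  nonanticipating : ∀ T ≤ (0 : ℝ), ∀ (n m : ℕ) (s : Fin n → ℝ) (t : Fin m → ℝ),
    (∀ k, s k ≤ T) → (∀ j, t j ∈ Icc T 0) →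
    IndepFun (fun ω k => Y (s k) ω) (fun ω j => x (t j) ω - x T ω) P
  /-- The finite-dimensional distributions of `Y` are invariant under time shifts. -/
  stationary : ∀ h ≥ (0 : ℝ), ∀ (n : ℕ) (t : Fin n → ℝ), (∀ k, t k ≤ 0) →
    IdentDistrib (fun ω k => Y (t k) ω) (fun ω k => Y (t k - h) ω) P P

/-- The process `s ↦ sup_{r ≤ s} (z(s) - z(r))`, coordinate by coordinate. -/
noncomputable def dominatingProcess (z : ℝ → Ω → Fin d → ℝ) (s : ℝ) (ω : Ω) : Fin d → ℝ :=
  fun i => ⨆ r : Iic s, (z s ω i - z r ω i)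

end ReflectedBM

open ReflectedBM

/-! The argument is pathwise; probability enters only through growth, laws and measurability. Since
`R` is an M-matrix, `R⁻¹ ≥ 0` (Neumann series), and the non-negative matrix `1 - R` contracts the
sup norm weighted by `w = R⁻¹ 1`. A Skorokhod solution with free input `ξ` amounts to a fixed point
`L_i(t) = sup_{s ≤ t} (-ξ + (1 - R) L)_i⁺(s)`. Banach's theorem gives existence, and Picard iterates
give measurable dependence on the input. The same contraction shows that `L` is the least
non-negative monotone path `U` with `ξ + R U ≥ 0` (`IsRegulator.le_of_nonneg`), whence uniqueness.

Minimality becomes a comparison principle (`IsReflectedPath.inv_mulVec_le`): if `u ≥ 0`, `R⁻¹(u -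
x)` is non-decreasing and `R⁻¹ y ≤ R⁻¹ u` at the initial time, then `R⁻¹ y ≤ R⁻¹ u` throughout. The
path `u = Y⁺` qualifies because `R⁻¹(Y⁺ - x) = R⁻¹(Y⁺ - ζ) - t R⁻¹ z`, where `ζ = x - t z`: the
first term is monotone since `Y⁺ - ζ` is minus a running infimum, the second since `R⁻¹ z ≤ 0`.
Hence `Y_S` is below `Y⁺ = Y_T` at time `T`, and therefore below `Y_T` afterwards. In
`R⁻¹`-coordinates the coupled paths decrease as the start recedes and are bounded below by `0`, so
they converge; Lipschitz dependence on the initial value makes the limit a reflected path.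

Both `Y⁺` and the limit are functionals `F` of the forward path `w` with `F(shift_h w)(t) = F(w)(t -
h)`. Stationary increments of `X` therefore give stationarity. Up to time `T` they depend only on
the increments of `X` after `-T`, while the input on `[T, 0]` depends only on `X` before `-T`, which
gives independence. Sublinear growth of Brownian motion and `v < z` make `Y⁺` finite. -/

namespace ReflectedBM

/-! ### M-matrices: positive inverse and weighted contraction. -/

section Matrices

open scoped Matrix.Norms.Operator in
/-- The powers of a matrix of spectral radius less than one are summable. -/
lemma summable_pow_of_spectralRadius_lt_one {d : ℕ} {Q : Matrix (Fin d) (Fin d) ℂ}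
    (h : spectralRadius ℂ Q < 1) : Summable (fun n : ℕ => Q ^ n) := by
  obtain ⟨r, hr, hr1⟩ := ENNReal.lt_iff_exists_nnreal_btwn.1 h
  have hG := spectrum.pow_nnnorm_pow_one_div_tendsto_nhds_spectralRadius Q
  have hr1' : r < 1 := by exact_mod_cast hr1
  refine Summable.of_norm_bounded_eventually_nat (g := fun n => (r : ℝ) ^ n)
    (summable_geometric_of_lt_one r.2 hr1') ?_
  filter_upwards [hG.eventually_lt_const hr, eventually_gt_atTop 0] with n hn hn0
  have h1 : ((‖Q ^ n‖₊ : ℝ≥0∞) ^ (1 / n : ℝ)) ^ (n : ℝ) ≤ (r : ℝ≥0∞) ^ (n : ℝ) := by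
    gcongr
  rw [← ENNReal.rpow_mul, one_div, inv_mul_cancel₀ (by positivity), ENNReal.rpow_one,
    ENNReal.rpow_natCast] at h1
  have h2 : ‖Q ^ n‖₊ ≤ r ^ n := by exact_mod_cast h1
  exact_mod_cast h2

-- The inverse is the Neumann series `∑ Q ^ n`, a sum of entrywise non-negative matrices.
open scoped Matrix.Norms.Operator in
lemma IsMMatrix.exists_nonneg_inverse {d : ℕ} {Q : Matrix (Fin d) (Fin d) ℝ}
    (hQ : ∀ i j, 0 ≤ Q i j) (h : spectralRadius ℂ (Q.map (algebraMap ℝ ℂ)) < 1) :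
    ∃ S : Matrix (Fin d) (Fin d) ℝ, (∀ i j, 0 ≤ S i j) ∧ (1 - Q) * S = 1 := by
  have hs := summable_pow_of_spectralRadius_lt_one h
  -- The spectral radius is complex, so summability is proved over `ℂ` and brought back by entrywise
  -- real parts.
  have hs' : Summable (fun n : ℕ => Q ^ n) := by
    have := hs.map (Complex.reAddGroupHom.mapMatrix (m := Fin d) (n := Fin d))
      (by
        refine continuous_matrix fun i j => ?_
        exact Complex.continuous_re.comp (continuous_apply_apply i j))
    convert this using 2 with n
    rw [Function.comp_apply, ← Matrix.map_pow]
    ext i j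
    simp
  have hpow : ∀ (n : ℕ) (i j : Fin d), 0 ≤ (Q ^ n) i j := by
    intro n
    induction n with
    | zero => intro i j; simp only [pow_zero, Matrix.one_apply]; split_ifs <;> simp
    | succ n ih =>
      intro i j
      rw [pow_succ, Matrix.mul_apply]
      exact Finset.sum_nonneg fun k _ => mul_nonneg (ih i k) (hQ k j)
  refine ⟨∑' n : ℕ, Q ^ n, fun i j => ?_, ?_⟩
  · have h1 : HasSum (fun n : ℕ => (Q ^ n) i j) ((∑' n : ℕ, Q ^ n) i j) := by
      have := hs'.hasSum
      exact this.map (Matrix.entryAddHom ℝ i j) (continuous_apply_apply i j)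
    exact h1.nonneg fun n => hpow n i j
  · exact hs'.one_sub_mul_tsum_pow

lemma mulVec_mono {d : ℕ} {S : Matrix (Fin d) (Fin d) ℝ} (hS : ∀ i j, 0 ≤ S i j)
    {x y : Fin d → ℝ} (h : x ≤ y) : S *ᵥ x ≤ S *ᵥ y := fun i => by
  simp only [Matrix.mulVec, dotProduct]
  exact Finset.sum_le_sum fun j _ => mul_le_mul_of_nonneg_left (h j) (hS i j)

lemma mulVec_nonneg {d : ℕ} {S : Matrix (Fin d) (Fin d) ℝ} (hS : ∀ i j, 0 ≤ S i j)
    {x : Fin d → ℝ} (h : 0 ≤ x) : 0 ≤ S *ᵥ x := fun i => by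
  simp only [Matrix.mulVec, dotProduct, Pi.zero_apply]
  exact Finset.sum_nonneg fun j _ => mul_nonneg (hS i j) (h j)

namespace IsMMatrix

variable {d : ℕ} {R : Matrix (Fin d) (Fin d) ℝ}

lemma one : IsMMatrix (1 : Matrix (Fin d) (Fin d) ℝ) :=
  ⟨0, by simp, by simp, by simp⟩

lemma one_sub_nonneg (hR : IsMMatrix R) (i j : Fin d) : 0 ≤ (1 - R) i j := by
  obtain ⟨Q, hQ, -, rfl⟩ := hR
  simpa using hQ i j

lemma isUnit_det (hR : IsMMatrix R) : IsUnit R.det := by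
  obtain ⟨Q, hQ, h, rfl⟩ := hR
  obtain ⟨S, -, hS⟩ := exists_nonneg_inverse hQ h
  exact Matrix.isUnit_det_of_right_inverse hS

lemma inv_nonneg (hR : IsMMatrix R) (i j : Fin d) : 0 ≤ R⁻¹ i j := by
  obtain ⟨Q, hQ, h, rfl⟩ := hR
  obtain ⟨S, hS0, hS⟩ := exists_nonneg_inverse hQ h
  rw [Matrix.inv_eq_right_inv hS]
  exact hS0 i j

lemma mulVec_inv_mulVec (hR : IsMMatrix R) (x : Fin d → ℝ) : R *ᵥ (R⁻¹ *ᵥ x) = x := by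
  rw [Matrix.mulVec_mulVec, Matrix.mul_nonsing_inv _ hR.isUnit_det, Matrix.one_mulVec]

lemma inv_mulVec_mulVec (hR : IsMMatrix R) (x : Fin d → ℝ) : R⁻¹ *ᵥ (R *ᵥ x) = x := by
  rw [Matrix.mulVec_mulVec, Matrix.nonsing_inv_mul _ hR.isUnit_det, Matrix.one_mulVec]

/-- A weight vector for which `1 - R` is a strict contraction. -/
lemma exists_weight (hR : IsMMatrix R) : ∃ w : Fin d → ℝ, (∀ i, 1 ≤ w i) ∧ R *ᵥ w = 1 := by
  have h1 : R *ᵥ (R⁻¹ *ᵥ (1 : Fin d → ℝ)) = 1 := hR.mulVec_inv_mulVec 1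
  have h0 : 0 ≤ R⁻¹ *ᵥ (1 : Fin d → ℝ) := mulVec_nonneg hR.inv_nonneg zero_le_one
  refine ⟨R⁻¹ *ᵥ 1, fun i => ?_, h1⟩
  have h2 := mulVec_nonneg hR.one_sub_nonneg h0 i
  rw [Matrix.sub_mulVec, h1, Matrix.one_mulVec] at h2
  simpa using h2

/-- Since `R w = 1`, `(1 - R) w = w - 1`. With `W = 1 + ∑ w i` one has `w i ≤ W`, so `1 ≥ w i / W`
and `c = 1 - 1 / W` works; the added `1` keeps `W ≥ 1` even when `d = 0`. -/
lemma exists_contraction (hR : IsMMatrix R) : ∃ (w : Fin d → ℝ) (c : ℝ), (∀ i, 1 ≤ w i) ∧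
    R *ᵥ w = 1 ∧ 0 ≤ c ∧ c < 1 ∧ (1 - R) *ᵥ w ≤ c • w := by
  obtain ⟨w, hw, hRw⟩ := hR.exists_weight
  have hw0 : ∀ i, 0 ≤ w i := fun i => zero_le_one.trans (hw i)
  have hW : 1 ≤ 1 + ∑ i, w i := by
    have := Finset.sum_nonneg fun i (_ : i ∈ Finset.univ) => hw0 i
    linarith
  refine ⟨w, 1 - (1 + ∑ i, w i)⁻¹, hw, hRw, ?_, ?_, fun i => ?_⟩
  · have := inv_le_one_of_one_le₀ hW
    linarith
  · have : 0 < (1 + ∑ i, w i)⁻¹ := by positivity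
    linarith
  · have h1 : w i ≤ 1 + ∑ i, w i := by
      have := Finset.single_le_sum (fun i (_ : i ∈ Finset.univ) => hw0 i) (Finset.mem_univ i)
      linarith
    have h2 : (1 + ∑ i, w i)⁻¹ * w i ≤ 1 := by
      rw [inv_mul_le_iff₀ (by linarith)]
      linarith
    rw [Matrix.sub_mulVec, hRw, Matrix.one_mulVec]
    simp only [Pi.sub_apply, Pi.one_apply, Pi.smul_apply, smul_eq_mul]
    linarith

end IsMMatrix

end Matrices

/-! ### Running maxima of continuous functions. -/

section RunningMaximum

/-- The running maximum `sup_{a ≤ s ≤ t} g(s)`. -/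
noncomputable def runMax (a : ℝ) (g : ℝ → ℝ) (t : ℝ) : ℝ :=
  ⨆ u : unitInterval, g (a + u * (t - a))

variable {a t : ℝ} {g : ℝ → ℝ}

lemma add_mul_sub_mem_Icc (hat : a ≤ t) (u : unitInterval) : a + u * (t - a) ∈ Icc a t := by
  have h0 := u.2.1
  have h1 := u.2.2
  constructor <;> nlinarith

lemma exists_add_mul_sub_eq (hat : a ≤ t) {s : ℝ} (hs : s ∈ Icc a t) :
    ∃ u : unitInterval, a + u * (t - a) = s := by
  rcases hat.eq_or_lt with rfl | hlt
  · exact ⟨0, by simpa using le_antisymm hs.1 hs.2⟩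
  · have h : 0 < t - a := sub_pos.2 hlt
    refine ⟨⟨(s - a) / (t - a), div_nonneg (sub_nonneg.2 hs.1) h.le, ?_⟩, ?_⟩
    · rw [div_le_one h]
      linarith [hs.2]
    · simp only
      field_simp
      ring

lemma continuous_comp_add_mul_sub (hat : a ≤ t) (hg : ContinuousOn g (Icc a t)) :
    Continuous fun u : unitInterval => g (a + u * (t - a)) :=
  hg.comp_continuous (by fun_prop) (add_mul_sub_mem_Icc hat)

lemma le_runMax (hat : a ≤ t) (hg : ContinuousOn g (Icc a t)) {s : ℝ} (hs : s ∈ Icc a t) :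
    g s ≤ runMax a g t := by
  obtain ⟨u, rfl⟩ := exists_add_mul_sub_eq hat hs
  exact le_ciSup (f := fun u : unitInterval => g (a + u * (t - a)))
    (isCompact_range (continuous_comp_add_mul_sub hat hg)).bddAbove u

lemma runMax_le (hat : a ≤ t) {c : ℝ} (h : ∀ s ∈ Icc a t, g s ≤ c) : runMax a g t ≤ c :=
  ciSup_le fun u => h _ (add_mul_sub_mem_Icc hat u)

lemma exists_eq_runMax (hat : a ≤ t) (hg : ContinuousOn g (Icc a t)) :
    ∃ s ∈ Icc a t, g s = runMax a g t := by
  obtain ⟨s, hs, hmax⟩ := isCompact_Icc.exists_isMaxOn (nonempty_Icc.2 hat) hg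
  exact ⟨s, hs, le_antisymm (le_runMax hat hg hs) (runMax_le hat hmax)⟩

lemma runMax_congr (hat : a ≤ t) {g' : ℝ → ℝ} (h : EqOn g g' (Icc a t)) :
    runMax a g t = runMax a g' t :=
  iSup_congr fun u => h (add_mul_sub_mem_Icc hat u)

lemma monotoneOn_runMax {b : ℝ} (hg : ContinuousOn g (Icc a b)) :
    MonotoneOn (runMax a g) (Icc a b) := fun _ hs _ ht hst =>
  runMax_le hs.1 fun _ hr =>
    le_runMax ht.1 (hg.mono (Icc_subset_Icc_right ht.2)) ⟨hr.1, hr.2.trans hst⟩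

/-- Parametrising `[a, t]` by the unit interval makes the index set a fixed compact space, over
which suprema vary continuously. -/
lemma continuous_runMax (hg : Continuous g) : Continuous (runMax a g) := by
  have h := isCompact_univ.continuous_sSup (K := (univ : Set unitInterval))
    (f := fun (t : ℝ) (u : unitInterval) => g (a + u * (t - a)))
    (by simp only [Function.HasUncurry.uncurry, id]; fun_prop)
  simp only [image_univ] at h
  exact h

lemma runMax_comp_sub (h : ℝ) : runMax (a + h) (fun s => g (s - h)) (t + h) = runMax a g t :=
  iSup_congr fun u => congrArg g (by ring)

lemma runMax_le_runMax_add (hat : a ≤ t) {g' : ℝ → ℝ} (hg' : ContinuousOn g' (Icc a t)) {c : ℝ}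
    (h : ∀ s ∈ Icc a t, g s ≤ g' s + c) : runMax a g t ≤ runMax a g' t + c :=
  runMax_le hat fun s hs => (h s hs).trans (by gcongr; exact le_runMax hat hg' hs)

end RunningMaximum

/-! ### The regulator equation: minimality and uniqueness. -/

section Regulator

variable {d : ℕ} {R : Matrix (Fin d) (Fin d) ℝ} {a b : ℝ} {ξ ℓ : ℝ → Fin d → ℝ}

/-- The regulator equation: `ℓ` is the running maximum of `(-ξ + (1 - R) ℓ)⁺`. -/
structure IsRegulator (R : Matrix (Fin d) (Fin d) ℝ) (a b : ℝ) (ξ ℓ : ℝ → Fin d → ℝ) : Prop where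
  continuousOn : ContinuousOn ℓ (Icc a b)
  eq_runMax : ∀ t ∈ Icc a b, ∀ i,
    ℓ t i = runMax a (fun s => max 0 (ℓ s i - (ξ s i + (R *ᵥ ℓ s) i))) t

lemma continuousOn_mulVec {S : Matrix (Fin d) (Fin d) ℝ} {f : ℝ → Fin d → ℝ} {s : Set ℝ}
    (hf : ContinuousOn f s) : ContinuousOn (fun t => S *ᵥ f t) s :=
  (Continuous.matrix_mulVec continuous_const continuous_id).comp_continuousOn hf

namespace IsRegulator

lemma continuousOn_integrand (h : IsRegulator R a b ξ ℓ) (hξ : ContinuousOn ξ (Icc a b))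
    (i : Fin d) : ContinuousOn (fun s => max 0 (ℓ s i - (ξ s i + (R *ᵥ ℓ s) i))) (Icc a b) := by
  have h1 := continuousOn_pi.1 h.continuousOn i
  have h2 := continuousOn_pi.1 hξ i
  have h3 := continuousOn_pi.1 (continuousOn_mulVec (S := R) h.continuousOn) i
  exact continuousOn_const.sup (h1.sub (h2.add h3))

lemma integrand_le (h : IsRegulator R a b ξ ℓ) (hξ : ContinuousOn ξ (Icc a b)) (i : Fin d)
    {s t : ℝ} (ht : t ∈ Icc a b) (hs : s ∈ Icc a t) :
    max 0 (ℓ s i - (ξ s i + (R *ᵥ ℓ s) i)) ≤ ℓ t i := by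
  rw [h.eq_runMax t ht i]
  exact le_runMax (g := fun s => max 0 (ℓ s i - (ξ s i + (R *ᵥ ℓ s) i))) ht.1
    ((h.continuousOn_integrand hξ i).mono (Icc_subset_Icc_right ht.2)) hs

lemma nonneg (h : IsRegulator R a b ξ ℓ) (hξ : ContinuousOn ξ (Icc a b)) {t : ℝ}
    (ht : t ∈ Icc a b) (i : Fin d) : 0 ≤ ℓ t i :=
  (le_max_left _ _).trans (h.integrand_le hξ i ht (right_mem_Icc.2 ht.1))

lemma monotoneOn (h : IsRegulator R a b ξ ℓ) (hξ : ContinuousOn ξ (Icc a b)) (i : Fin d) :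
    MonotoneOn (fun t => ℓ t i) (Icc a b) := by
  refine (monotoneOn_runMax (h.continuousOn_integrand hξ i)).congr fun t ht => ?_
  exact (h.eq_runMax t ht i).symm

lemma reflected_nonneg (h : IsRegulator R a b ξ ℓ) (hξ : ContinuousOn ξ (Icc a b)) {t : ℝ}
    (ht : t ∈ Icc a b) (i : Fin d) : 0 ≤ ξ t i + (R *ᵥ ℓ t) i := by
  have := (le_max_right _ _).trans (h.integrand_le hξ i ht (right_mem_Icc.2 ht.1))
  linarith

/-- One round of the contraction: for `s ≤ t`, `-ξ(s) + (1 - R) ℓ(s) ≤ -ξ(s) + (1 - R) U(s) + m (1 -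
R) w ≤ U(s) + m c w ≤ U(t) + m c w`; then take the running maximum. -/
lemma le_of_le_smul (hR : IsMMatrix R) (h : IsRegulator R a b ξ ℓ) {U : ℝ → Fin d → ℝ}
    (hUm : ∀ i, MonotoneOn (fun t => U t i) (Icc a b)) (hU0 : ∀ t ∈ Icc a b, ∀ i, 0 ≤ U t i)
    (hU : ∀ t ∈ Icc a b, ∀ i, 0 ≤ ξ t i + (R *ᵥ U t) i) {w : Fin d → ℝ} {c m : ℝ}
    (hm : 0 ≤ m) (hw0 : 0 ≤ c • w) (hw : (1 - R) *ᵥ w ≤ c • w)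
    (hle : ∀ t ∈ Icc a b, ℓ t ≤ U t + m • w) (t : ℝ) (ht : t ∈ Icc a b) :
    ℓ t ≤ U t + (m * c) • w := by
  intro i
  have hw0i := hw0 i
  simp only [Pi.add_apply, Pi.smul_apply, smul_eq_mul, Pi.zero_apply] at hw0i ⊢
  rw [h.eq_runMax t ht i]
  refine runMax_le ht.1 fun s hs => max_le ?_ ?_
  · have := hU0 t ht i
    nlinarith
  · have hs' : s ∈ Icc a b := ⟨hs.1, hs.2.trans ht.2⟩
    have h1 := hU s hs' i
    have h2 := mulVec_mono hR.one_sub_nonneg (hle s hs') i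
    have h3 := hw i
    have h4 := hUm i hs' ht hs.2
    rw [Matrix.mulVec_add, Matrix.mulVec_smul] at h2
    simp only [Pi.add_apply, Pi.smul_apply, smul_eq_mul, Matrix.sub_mulVec, Matrix.one_mulVec,
      Pi.sub_apply] at h2 h3 h4
    have h5 := mul_le_mul_of_nonneg_left h3 hm
    linarith

/-- The regulator is the least monotone path keeping the reflected path non-negative. -/
theorem le_of_nonneg (hR : IsMMatrix R) (h : IsRegulator R a b ξ ℓ) {U : ℝ → Fin d → ℝ}
    (hUm : ∀ i, MonotoneOn (fun t => U t i) (Icc a b)) (hU0 : ∀ t ∈ Icc a b, ∀ i, 0 ≤ U t i)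
    (hU : ∀ t ∈ Icc a b, ∀ i, 0 ≤ ξ t i + (R *ᵥ U t) i) (t : ℝ) (ht : t ∈ Icc a b) :
    ℓ t ≤ U t := by
  obtain ⟨w, c, hw1, -, hc0, hc1, hw⟩ := hR.exists_contraction
  have hw0 : 0 ≤ w := fun i => zero_le_one.trans (hw1 i)
  obtain ⟨C, hC⟩ := isCompact_Icc.exists_bound_of_continuousOn h.continuousOn
  have hC0 : 0 ≤ C := (norm_nonneg _).trans (hC t ht)
  -- The sup bound `C` starts the iteration, since `w ≥ 1`; each round gains a factor `c`.
  have key : ∀ n : ℕ, ∀ t ∈ Icc a b, ℓ t ≤ U t + (C * c ^ n) • w := by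
    intro n
    induction n with
    | zero =>
      intro t ht i
      have h1 : ℓ t i ≤ C := (Real.le_norm_self _).trans ((norm_le_pi_norm _ i).trans (hC t ht))
      have h2 := hU0 t ht i
      have h3 : C * 1 ≤ C * w i := mul_le_mul_of_nonneg_left (hw1 i) hC0
      simp only [pow_zero, Pi.add_apply, Pi.smul_apply, smul_eq_mul]
      linarith
    | succ n ih =>
      intro t ht
      have := le_of_le_smul hR h hUm hU0 hU (m := C * c ^ n) (by positivity)
        (smul_nonneg hc0 hw0) hw ih t ht
      rwa [pow_succ, ← mul_assoc]
  intro i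
  have hlim : Tendsto (fun n : ℕ => U t i + (C * c ^ n) * w i) atTop (𝓝 (U t i + C * 0 * w i)) :=
    (((tendsto_pow_atTop_nhds_zero_of_lt_one hc0 hc1).const_mul C).mul_const _).const_add _
  simpa using ge_of_tendsto' hlim fun n => key n t ht i

theorem unique (hR : IsMMatrix R) (hξ : ContinuousOn ξ (Icc a b)) (h : IsRegulator R a b ξ ℓ)
    {ℓ' : ℝ → Fin d → ℝ} (h' : IsRegulator R a b ξ ℓ') : EqOn ℓ ℓ' (Icc a b) := fun t ht =>
  le_antisymm
    (h.le_of_nonneg hR (h'.monotoneOn hξ) (fun _ hs => h'.nonneg hξ hs)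
      (fun _ hs => h'.reflected_nonneg hξ hs) t ht)
    (h'.le_of_nonneg hR (h.monotoneOn hξ) (fun _ hs => h.nonneg hξ hs)
      (fun _ hs => h.reflected_nonneg hξ hs) t ht)

lemma mono_right (h : IsRegulator R a b ξ ℓ) {c : ℝ} (hc : c ≤ b) : IsRegulator R a c ξ ℓ where
  continuousOn := h.continuousOn.mono (Icc_subset_Icc_right hc)
  eq_runMax t ht := h.eq_runMax t ⟨ht.1, ht.2.trans hc⟩

/-- Minimality on the degenerate interval `[a, a]`, with competitor `0`. -/
lemma eq_zero_left (hR : IsMMatrix R) (hab : a ≤ b) (h : IsRegulator R a b ξ ℓ)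
    (hξ : ContinuousOn ξ (Icc a b)) (hξ0 : 0 ≤ ξ a) : ℓ a = 0 := by
  refine le_antisymm ?_ fun i => h.nonneg hξ (left_mem_Icc.2 hab) i
  refine (h.mono_right hab).le_of_nonneg hR (U := 0) (fun i => ?_) (fun t ht i => ?_)
    (fun t ht i => ?_) a (left_mem_Icc.2 le_rfl)
  · exact monotoneOn_const
  · simp
  · rw [Icc_self, mem_singleton_iff] at ht
    subst ht
    simpa using hξ0 i

lemma congr (h : IsRegulator R a b ξ ℓ) {ξ' : ℝ → Fin d → ℝ} (hξ : EqOn ξ ξ' (Icc a b)) :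
    IsRegulator R a b ξ' ℓ where
  continuousOn := h.continuousOn
  eq_runMax t ht i := by
    rw [h.eq_runMax t ht i]
    refine runMax_congr ht.1 fun s hs => ?_
    simp only [hξ ⟨hs.1, hs.2.trans ht.2⟩]

lemma comp_sub (h : IsRegulator R a b ξ ℓ) (r : ℝ) :
    IsRegulator R (a + r) (b + r) (fun t => ξ (t - r)) (fun t => ℓ (t - r)) where
  continuousOn := h.continuousOn.comp (by fun_prop)
    fun t ht => ⟨by linarith [ht.1], by linarith [ht.2]⟩
  eq_runMax t ht i := by
    rw [h.eq_runMax (t - r) ⟨by linarith [ht.1], by linarith [ht.2]⟩ i, ← runMax_comp_sub r,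
      sub_add_cancel]

end IsRegulator

end Regulator

/-! ### Equivalence of the Skorokhod problem and the regulator equation. -/

section SkorokhodRegulator

variable {d : ℕ} {R : Matrix (Fin d) (Fin d) ℝ} {a b : ℝ} {x y ξ ℓ : ℝ → Fin d → ℝ}
  {L : Fin d → StieltjesFunction ℝ}

/-- The integrand is `(L - y)⁺`, so the running maximum is at most `L(t)`. If it were smaller, `L`
would take an intermediate value at some `s₀`; after `s₀` one has `L > L - y`, so `y > 0`, and
complementarity forbids any further growth of `L`. -/
lemma IsSkorokhodSolution.isRegulator (hR : IsMMatrix R) (h : IsSkorokhodSolution R a b x y L)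
    (hx : ContinuousOn x (Icc a b)) :
    IsRegulator R a b (fun t => y a + (x t - x a)) (fun t i => L i t) := by
  have hy : ∀ t ∈ Icc a b, ∀ i, y a i + (x t i - x a i) + (R *ᵥ fun i => L i t) i = y t i := by
    intro t ht i
    rw [h.equation t ht]
    simp
  -- Solving for `L` shows that it is continuous, although only right-continuity was assumed.
  have hL : EqOn (fun t i => L i t) (fun t => R⁻¹ *ᵥ (y t - (y a + (x t - x a)))) (Icc a b) := by
    intro t ht
    simp only
    rw [h.equation t ht, add_sub_cancel_left, hR.inv_mulVec_mulVec]
  have hLc : ContinuousOn (fun t i => L i t) (Icc a b) :=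
    (continuousOn_mulVec (h.continuousOn.sub
      (continuousOn_const.add (hx.sub continuousOn_const)))).congr hL
  refine ⟨hLc, fun t ht i => ?_⟩
  have hLi : ContinuousOn (fun t => L i t) (Icc a b) := continuousOn_pi.1 hLc i
  have hyi : ContinuousOn (fun t => y t i) (Icc a b) := continuousOn_pi.1 h.continuousOn i
  have hsub : Icc a t ⊆ Icc a b := Icc_subset_Icc_right ht.2
  rw [runMax_congr ht.1 (g' := fun s => max 0 (L i s - y s i)) fun s hs => by
    simp only [Pi.add_apply, Pi.sub_apply, hy s (hsub hs) i]]
  have hg : ContinuousOn (fun s => max 0 (L i s - y s i)) (Icc a t) :=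
    (continuousOn_const.sup (hLi.sub hyi)).mono hsub
  refine le_antisymm ?_ (runMax_le ht.1 fun s hs => max_le ?_ ?_)
  · by_contra! hlt
    obtain ⟨c, hMc, hcL⟩ := exists_between hlt
    have h0 : 0 ≤ runMax a (fun s => max 0 (L i s - y s i)) t :=
      (le_max_left _ _).trans (le_runMax ht.1 hg (left_mem_Icc.2 ht.1))
    obtain ⟨s₀, hs₀, rfl⟩ : c ∈ (fun t => L i t) '' Icc a t :=
      intermediate_value_Icc ht.1 (hLi.mono hsub)
        ⟨by simp only [h.pushing_zero i]; linarith, hcL.le⟩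
    have hpos : ∀ s ∈ Ioc s₀ t, 0 < y s i := by
      intro s hs
      have h1 := le_runMax ht.1 hg (s := s) ⟨hs₀.1.trans hs.1.le, hs.2⟩
      have h2 : L i s₀ ≤ L i s := (L i).mono hs.1.le
      have h3 := (le_max_right 0 (L i s - y s i)).trans h1
      simp only at hMc
      linarith
    have hcompl := h.complementarity i
    rw [lintegral_eq_zero_iff' ((hyi.mono Ioc_subset_Icc_self).aemeasurable
      measurableSet_Ioc).ennreal_ofReal, Filter.EventuallyEq, ae_restrict_iff' measurableSet_Ioc]
      at hcompl
    have hnull : (L i).measure (Ioc s₀ t) = 0 := by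
      refine measure_mono_null (fun s hs => ?_) (ae_iff.1 hcompl)
      simp only [mem_ofPred_eq, Classical.not_imp, Pi.zero_apply, ENNReal.ofReal_eq_zero, not_le]
      exact ⟨⟨hs₀.1.trans_lt hs.1, hs.2.trans ht.2⟩, hpos s hs⟩
    rw [StieltjesFunction.measure_Ioc, ENNReal.ofReal_eq_zero] at hnull
    simp only at hcL
    linarith
  · rw [← h.pushing_zero i]
    exact (L i).mono ht.1
  · have h1 : L i s ≤ L i t := (L i).mono hs.2
    have h2 := h.nonneg s (hsub hs) i
    linarith

namespace IsRegulator

/-- The maximum defining `ℓ q` is attained at some `s`. If `s > p` and the value there exceeded `ℓ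
p`, it would be `ℓ s - y s < ℓ s ≤ ℓ q`, where `y = ξ + R ℓ`: a contradiction. -/
lemma eq_of_pos (h : IsRegulator R a b ξ ℓ) (hξ : ContinuousOn ξ (Icc a b)) (i : Fin d)
    {p q : ℝ} (hp : a ≤ p) (hpq : p ≤ q) (hq : q ≤ b)
    (hpos : ∀ s ∈ Ioc p q, 0 < ξ s i + (R *ᵥ ℓ s) i) : ℓ p i = ℓ q i := by
  have hpm : p ∈ Icc a b := ⟨hp, hpq.trans hq⟩
  have hqm : q ∈ Icc a b := ⟨hp.trans hpq, hq⟩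
  refine le_antisymm (h.monotoneOn hξ i hpm hqm hpq) ?_
  obtain ⟨s, hs, hs'⟩ := exists_eq_runMax hqm.1
    ((h.continuousOn_integrand hξ i).mono (Icc_subset_Icc_right hq))
  rw [← h.eq_runMax q hqm i] at hs'
  rw [← hs']
  rcases le_or_gt s p with hsp | hsp
  · exact h.integrand_le hξ i hpm ⟨hs.1, hsp⟩
  · refine max_le (h.nonneg hξ hpm i) ?_
    by_contra! hlt
    have h1 := hpos s ⟨hsp, hs.2⟩
    have h2 : ℓ s i ≤ ℓ q i := h.monotoneOn hξ i ⟨hs.1, hs.2.trans hq⟩ hqm hs.2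
    rw [max_eq_right ((h.nonneg hξ hpm i).trans hlt.le)] at hs'
    linarith

/-- The Stieltjes function obtained by extending a coordinate of a regulator by constants. -/
noncomputable def stieltjes (h : IsRegulator R a b ξ ℓ) (hξ : ContinuousOn ξ (Icc a b))
    (hab : a ≤ b) (i : Fin d) : StieltjesFunction ℝ where
  toFun t := ℓ (projIcc a b hab t) i
  mono' _ _ hst := h.monotoneOn hξ i (projIcc a b hab _).2 (projIcc a b hab _).2
    (monotone_projIcc hab hst)
  right_continuous' _ := ((continuousOn_pi.1 h.continuousOn i).comp_continuous
    (continuous_subtype_val.comp continuous_projIcc)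
    fun t => (projIcc a b hab t).2).continuousWithinAt

lemma stieltjes_apply (h : IsRegulator R a b ξ ℓ) (hξ : ContinuousOn ξ (Icc a b))
    (hab : a ≤ b) (i : Fin d) {t : ℝ} (ht : t ∈ Icc a b) : h.stieltjes hξ hab i t = ℓ t i := by
  change ℓ (projIcc a b hab t) i = ℓ t i
  rw [projIcc_of_mem hab ht]

theorem isSkorokhodSolution (hR : IsMMatrix R) (h : IsRegulator R a b ξ ℓ)
    (hξ : ContinuousOn ξ (Icc a b)) (hab : a ≤ b) (hξ0 : 0 ≤ ξ a) :
    IsSkorokhodSolution R a b ξ (fun t => ξ t + R *ᵥ ℓ t) (h.stieltjes hξ hab) := by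
  have ha : ℓ a = 0 := h.eq_zero_left hR hab hξ hξ0
  have hyc : ContinuousOn (fun t => ξ t + R *ᵥ ℓ t) (Icc a b) :=
    hξ.add (continuousOn_mulVec h.continuousOn)
  refine ⟨hyc, fun t ht => ?_, fun t ht i => h.reflected_nonneg hξ ht i, fun i => ?_, fun i => ?_⟩
  · simp only [h.stieltjes_apply hξ hab _ ht, ha, Matrix.mulVec_zero]
    abel
  · rw [h.stieltjes_apply hξ hab i (left_mem_Icc.2 hab), ha, Pi.zero_apply]
  · have hnull : (h.stieltjes hξ hab i).measure (Ioc a b ∩ {t | 0 < (ξ t + R *ᵥ ℓ t) i}) = 0 := by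
      -- By continuity `y_i > 0` near each such `t`, so the regulator is flat there and its measure
      -- vanishes locally.
      refine measure_null_of_locally_null _ fun t ht => ?_
      have htm : t ∈ Icc a b := Ioc_subset_Icc_self ht.1
      have hnhds : {t | 0 < (ξ t + R *ᵥ ℓ t) i} ∈ 𝓝[Icc a b] t :=
        (continuousOn_pi.1 hyc i t htm).eventually_const_lt ht.2
      obtain ⟨ε, hε, hball⟩ := Metric.mem_nhdsWithin_iff.1 hnhds
      refine ⟨Ioc (max a (t - ε / 2)) (min b (t + ε / 2)), ?_, ?_⟩
      · refine mem_nhdsWithin.2 ⟨Ioo (t - ε / 2) (t + ε / 2), isOpen_Ioo,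
          ⟨by linarith, by linarith⟩, fun s hs => ⟨max_lt hs.2.1.1 hs.1.1, le_min hs.2.1.2 hs.1.2.le⟩⟩
      · have hpq : max a (t - ε / 2) ≤ min b (t + ε / 2) :=
          max_le (le_min hab (by linarith [ht.1.1])) (le_min (by linarith [ht.1.2]) (by linarith))
        have hpm : max a (t - ε / 2) ∈ Icc a b :=
          ⟨le_max_left _ _, hpq.trans (min_le_left _ _)⟩
        have hqm : min b (t + ε / 2) ∈ Icc a b :=
          ⟨(le_max_left _ _).trans hpq, min_le_left _ _⟩
        rw [StieltjesFunction.measure_Ioc, h.stieltjes_apply hξ hab i hpm,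
          h.stieltjes_apply hξ hab i hqm, h.eq_of_pos hξ i hpm.1 hpq hqm.2 fun s hs => ?_]
        · simp
        · refine hball ⟨?_, hpm.1.trans hs.1.le, hs.2.trans hqm.2⟩
          rw [Metric.mem_ball, Real.dist_eq, abs_lt]
          have h1 := (le_max_right _ _).trans_lt hs.1
          have h2 := hs.2.trans (min_le_right _ _)
          constructor <;> linarith
    have hae : ∀ᵐ t ∂(h.stieltjes hξ hab i).measure.restrict (Ioc a b),
        ENNReal.ofReal ((ξ t + R *ᵥ ℓ t) i) = 0 := by
      rw [ae_restrict_iff' measurableSet_Ioc, ae_iff]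
      refine measure_mono_null (fun t ht => ?_) hnull
      simp only [mem_ofPred_eq, Classical.not_imp, ENNReal.ofReal_eq_zero, not_le] at ht
      exact ht
    exact (lintegral_congr_ae hae).trans lintegral_zero

end IsRegulator

end SkorokhodRegulator

/-! ### Existence and measurability of regulators by Picard iteration. -/

section Existence

/-- By continuity in the index, exceeding a level somewhere means exceeding it on a countable dense
set. -/
lemma measurable_iSup_of_continuous {E ι : Type*} [MeasurableSpace E] [TopologicalSpace ι]
    [TopologicalSpace.SeparableSpace ι] [Nonempty ι] {f : E → ι → ℝ}
    (hc : ∀ e, Continuous (f e)) (hm : ∀ u, Measurable fun e => f e u)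
    (hb : ∀ e, BddAbove (range (f e))) : Measurable fun e => ⨆ u, f e u := by
  refine measurable_of_Ioi fun c => ?_
  have h : (fun e => ⨆ u, f e u) ⁻¹' Ioi c =
      ⋃ n : ℕ, {e | c < f e (TopologicalSpace.denseSeq ι n)} := by
    ext e
    simp only [mem_preimage, mem_Ioi, mem_iUnion, mem_ofPred_eq]
    rw [lt_ciSup_iff (hb e)]
    refine ⟨fun ⟨u, hu⟩ => ?_, fun ⟨n, hn⟩ => ⟨_, hn⟩⟩
    exact (TopologicalSpace.denseRange_denseSeq ι).exists_mem_open
      ((isOpen_Ioi (a := c)).preimage (hc e)) ⟨u, hu⟩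
  rw [h]
  exact MeasurableSet.iUnion fun n => measurableSet_lt measurable_const (hm _)

lemma measurable_runMax {E : Type*} [MeasurableSpace E] {a t : ℝ} {g : E → ℝ → ℝ}
    (hc : ∀ e, Continuous (g e)) (hm : ∀ s, Measurable fun e => g e s) :
    Measurable fun e => runMax a (g e) t := by
  have hcu : ∀ e, Continuous fun u : unitInterval => g e (a + u * (t - a)) :=
    fun e => (hc e).comp (by fun_prop)
  exact measurable_iSup_of_continuous hcu (fun u => hm _)
    fun e => (isCompact_range (hcu e)).bddAbove

variable {d : ℕ} {R : Matrix (Fin d) (Fin d) ℝ} {a b : ℝ}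

/-- The integrand of the regulator equation, in coordinates rescaled by the weight `w`. -/
noncomputable def picardIntegrand (R : Matrix (Fin d) (Fin d) ℝ) (hab : a ≤ b) (w : Fin d → ℝ)
    (ξ : ℝ → Fin d → ℝ) (f : C(Icc a b, Fin d → ℝ)) (i : Fin d) (s : ℝ) : ℝ :=
  max 0 (-ξ s i + ((1 - R) *ᵥ (w * f (projIcc a b hab s))) i)

lemma continuous_picardIntegrand (hab : a ≤ b) (w : Fin d → ℝ) {ξ : ℝ → Fin d → ℝ}
    (hξ : Continuous ξ) (f : C(Icc a b, Fin d → ℝ)) (i : Fin d) :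
    Continuous (picardIntegrand R hab w ξ f i) := by
  have h1 : Continuous fun s => (1 - R) *ᵥ (w * f (projIcc a b hab s)) :=
    continuous_const.matrix_mulVec
      (continuous_const.mul (f.continuous.comp continuous_projIcc))
  have h2 : Continuous fun s => ((1 - R) *ᵥ (w * f (projIcc a b hab s))) i :=
    (continuous_apply i).comp h1
  have h3 : Continuous fun s => ξ s i := (continuous_apply i).comp hξ
  exact continuous_const.max (h3.neg.add h2)

/-- The map whose fixed point is the regulator, in coordinates rescaled by the weight `w`. -/
noncomputable def picard (R : Matrix (Fin d) (Fin d) ℝ) (hab : a ≤ b) (w : Fin d → ℝ)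
    {ξ : ℝ → Fin d → ℝ} (hξ : Continuous ξ) (f : C(Icc a b, Fin d → ℝ)) :
    C(Icc a b, Fin d → ℝ) where
  toFun t i := (w i)⁻¹ * runMax a (picardIntegrand R hab w ξ f i) t
  continuous_toFun := continuous_pi fun i => continuous_const.mul
    ((continuous_runMax (continuous_picardIntegrand hab w hξ f i)).comp continuous_subtype_val)

/-- Rescaling by `w` turns the weighted norm into the sup norm: from `w f ≤ w g + dist f g • w` and
`1 - R ≥ 0`, the integrands differ by at most `dist f g * c * w i`. Exchanging `f` and `g` gives the
Lipschitz bound. -/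
lemma picard_apply_le (hR : IsMMatrix R) (hab : a ≤ b) {w : Fin d → ℝ} {c : ℝ}
    (hw1 : ∀ i, 1 ≤ w i) (hw : (1 - R) *ᵥ w ≤ c • w) {ξ : ℝ → Fin d → ℝ} (hξ : Continuous ξ)
    (f g : C(Icc a b, Fin d → ℝ)) (t : Icc a b) (i : Fin d) :
    picard R hab w hξ f t i ≤ picard R hab w hξ g t i + c * dist f g := by
  have hwi : 0 < w i := zero_lt_one.trans_le (hw1 i)
  have hD : 0 ≤ dist f g := dist_nonneg
  have h : runMax a (picardIntegrand R hab w ξ f i) t ≤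
      runMax a (picardIntegrand R hab w ξ g i) t + dist f g * (c * w i) := by
    refine runMax_le_runMax_add t.2.1 (continuous_picardIntegrand hab w hξ g i).continuousOn
      fun s _ => ?_
    have hc0 : 0 ≤ c * w i := by
      refine le_trans ?_ (hw i)
      exact mulVec_nonneg hR.one_sub_nonneg (fun j => zero_le_one.trans (hw1 j)) i
    unfold picardIntegrand
    refine max_le (add_nonneg (le_max_left _ _) (mul_nonneg hD hc0)) ?_
    set p := projIcc a b hab s
    have h1 : w * f p ≤ w * g p + dist f g • w := by
      intro j
      have h2 : f p j - g p j ≤ dist f g := (le_abs_self _).trans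
        ((dist_le_pi_dist (f p) (g p) j).trans (ContinuousMap.dist_apply_le_dist p))
      have h3 := mul_le_mul_of_nonneg_left h2 (zero_le_one.trans (hw1 j))
      simp only [Pi.mul_apply, Pi.add_apply, Pi.smul_apply, smul_eq_mul]
      linarith
    have h4 := mulVec_mono hR.one_sub_nonneg h1 i
    have h5 := mul_le_mul_of_nonneg_left (hw i) hD
    rw [Matrix.mulVec_add, Matrix.mulVec_smul] at h4
    simp only [Pi.add_apply, Pi.smul_apply, smul_eq_mul] at h4 h5
    have h6 := le_max_right 0 (-ξ s i + ((1 - R) *ᵥ (w * g p)) i)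
    linarith
  change (w i)⁻¹ * _ ≤ (w i)⁻¹ * _ + _
  have h' := mul_le_mul_of_nonneg_left h (inv_nonneg.2 hwi.le)
  refine h'.trans_eq ?_
  field_simp

lemma contractingWith_picard (hR : IsMMatrix R) (hab : a ≤ b) {w : Fin d → ℝ} {c : ℝ≥0}
    (hc1 : c < 1) (hw1 : ∀ i, 1 ≤ w i) (hw : (1 - R) *ᵥ w ≤ (c : ℝ) • w) {ξ : ℝ → Fin d → ℝ}
    (hξ : Continuous ξ) : ContractingWith c (picard R hab w hξ) := by
  refine ⟨hc1, LipschitzWith.of_dist_le_mul fun f g => ?_⟩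
  have h0 : 0 ≤ (c : ℝ) * dist f g := by positivity
  refine (ContinuousMap.dist_le h0).2 fun t => (dist_pi_le_iff h0).2 fun i => ?_
  have h1 := picard_apply_le hR hab hw1 hw hξ f g t i
  have h2 := picard_apply_le hR hab hw1 hw hξ g f t i
  rw [dist_comm g f] at h2
  rw [Real.dist_eq, abs_le]
  constructor <;> linarith

lemma measurable_picard_iterate {E : Type*} [MeasurableSpace E] (hab : a ≤ b) (w : Fin d → ℝ)
    {ξ : E → ℝ → Fin d → ℝ} (hξ : ∀ e, Continuous (ξ e)) (hm : ∀ s, Measurable fun e => ξ e s)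
    (n : ℕ) (t : Icc a b) : Measurable fun e => ((picard R hab w (hξ e))^[n] 0) t := by
  induction n generalizing t with
  | zero => exact measurable_const
  | succ n ih =>
    simp only [Function.iterate_succ_apply']
    refine measurable_pi_lambda _ fun i => Measurable.const_mul (measurable_runMax
      (fun e => continuous_picardIntegrand hab w (hξ e) _ i) fun s => ?_) _
    have h1 : Measurable fun e => ξ e s i := (measurable_pi_apply i).comp (hm s)
    have h2 : Measurable fun e => ((1 - R) *ᵥ
        (w * ((picard R hab w (hξ e))^[n] 0) (projIcc a b hab s))) i := by
      simp only [Matrix.mulVec, dotProduct, Pi.mul_apply]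
      exact Finset.measurable_sum _ fun j _ => Measurable.const_mul
        (Measurable.const_mul ((measurable_pi_apply j).comp (ih _)) _) _
    exact measurable_const.max (h1.neg.add h2)

/-- Regulators exist, and depend measurably on the input path. -/
theorem exists_isRegulator_measurable {E : Type*} [MeasurableSpace E] (hR : IsMMatrix R)
    (hab : a ≤ b) {ξ : E → ℝ → Fin d → ℝ} (hξ : ∀ e, Continuous (ξ e))
    (hm : ∀ s, Measurable fun e => ξ e s) :
    ∃ ℓ : E → ℝ → Fin d → ℝ, (∀ e, IsRegulator R a b (ξ e) (ℓ e)) ∧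
      ∀ t, Measurable fun e => ℓ e t := by
  obtain ⟨w, c, hw1, -, hc0, hc1, hw⟩ := hR.exists_contraction
  lift c to ℝ≥0 using hc0
  have hc1' : c < 1 := by exact_mod_cast hc1
  have hK := fun e => contractingWith_picard hR hab hc1' hw1 hw (hξ e)
  let p : E → C(Icc a b, Fin d → ℝ) := fun e => (hK e).fixedPoint _
  have hp : ∀ e, picard R hab w (hξ e) (p e) = p e := fun e => (hK e).fixedPoint_isFixedPt
  have hpc : ∀ e, Continuous fun t => w * p e (projIcc a b hab t) := fun e =>
    continuous_const.mul ((p e).continuous.comp continuous_projIcc)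
  refine ⟨fun e t => w * p e (projIcc a b hab t), fun e => ⟨(hpc e).continuousOn, ?_⟩, fun t => ?_⟩
  · intro t ht i
    have hwi : w i ≠ 0 := (zero_lt_one.trans_le (hw1 i)).ne'
    have h1 : p e (projIcc a b hab t) i =
        (w i)⁻¹ * runMax a (picardIntegrand R hab w (ξ e) (p e) i) t := by
      conv_lhs => rw [← hp e, projIcc_of_mem hab ht]
      rfl
    simp only
    rw [Pi.mul_apply, h1, mul_inv_cancel_left₀ hwi]
    refine runMax_congr ht.1 fun s hs => ?_
    simp only [picardIntegrand, Matrix.sub_mulVec, Matrix.one_mulVec, Pi.sub_apply]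
    congr 1
    ring
  · refine (measurable_pi_lambda _ fun i => Measurable.const_mul ?_ (w i))
    -- The fixed point is the pointwise limit of the measurable iterates started from `0`.
    refine (measurable_pi_apply i).comp (measurable_of_tendsto_metrizable
      (fun n => measurable_picard_iterate (R := R) hab w hξ hm n (projIcc a b hab t)) ?_)
    refine tendsto_pi_nhds.2 fun e => ?_
    exact ((continuous_eval_const (projIcc a b hab t)).tendsto _).comp
      ((hK e).tendsto_iterate_fixedPoint 0)

end Existence

/-! ### Reflected paths: restriction, comparison, stability. -/

section ReflectedPaths

variable {d : ℕ} {R : Matrix (Fin d) (Fin d) ℝ} {a b : ℝ} {x y : ℝ → Fin d → ℝ}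

theorem IsRegulator.isUniqueReflectedPath (hR : IsMMatrix R) (hab : a ≤ b) (hx : Continuous x)
    {y₀ : Fin d → ℝ} (hy₀ : 0 ≤ y₀) {ℓ : ℝ → Fin d → ℝ}
    (h : IsRegulator R a b (fun t => y₀ + (x t - x a)) ℓ) :
    IsUniqueReflectedPath R a b x y₀ (fun t => y₀ + (x t - x a) + R *ᵥ ℓ t) := by
  have hξ : ContinuousOn (fun t => y₀ + (x t - x a)) (Icc a b) := by fun_prop
  have h0 : 0 ≤ y₀ + (x a - x a) := by simpa using hy₀
  have hsol := h.isSkorokhodSolution hR hξ hab h0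
  have ha : ℓ a = 0 := h.eq_zero_left hR hab hξ h0
  refine ⟨⟨_, hsol.continuousOn, fun t ht => ?_, hsol.nonneg, hsol.pushing_zero,
    hsol.complementarity⟩, by simp [ha], ?_⟩
  · rw [hsol.equation t ht]
    congr 1
    abel
  · rintro y' ⟨L', h'⟩ rfl t ht
    have hu := h.unique hR hξ (h'.isRegulator hR hx.continuousOn) ht
    rw [h'.equation t ht]
    simp only
    rw [hu]

lemma exists_isUniqueReflectedPath_measurable {E : Type*} [MeasurableSpace E] (hR : IsMMatrix R)
    (hab : a ≤ b) {x : E → ℝ → Fin d → ℝ} {y₀ : E → Fin d → ℝ} (hx : ∀ e, Continuous (x e))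
    (hxm : ∀ t, Measurable fun e => x e t) (hy₀ : ∀ e, 0 ≤ y₀ e) (hy₀m : Measurable y₀) :
    ∃ y : E → ℝ → Fin d → ℝ, (∀ e, IsUniqueReflectedPath R a b (x e) (y₀ e) (y e)) ∧
      ∀ t, Measurable fun e => y e t := by
  obtain ⟨ℓ, hℓ, hm⟩ := exists_isRegulator_measurable (a := a) (b := b) hR hab
    (ξ := fun e t => y₀ e + (x e t - x e a))
    (fun e => continuous_const.add ((hx e).sub continuous_const))
    (fun t => hy₀m.add ((hxm t).sub (hxm a)))
  refine ⟨_, fun e => (hℓ e).isUniqueReflectedPath hR hab (hx e) (hy₀ e), fun t => ?_⟩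
  exact (hy₀m.add ((hxm t).sub (hxm a))).add
    ((continuous_const.matrix_mulVec continuous_id).measurable.comp (hm t))

lemma exists_isUniqueReflectedPath (hR : IsMMatrix R) (hab : a ≤ b) (hx : Continuous x)
    {y₀ : Fin d → ℝ} (hy₀ : 0 ≤ y₀) : ∃ y, IsUniqueReflectedPath R a b x y₀ y := by
  obtain ⟨y, hy, -⟩ := exists_isUniqueReflectedPath_measurable (E := Unit) hR hab
    (x := fun _ => x) (y₀ := fun _ => y₀) (fun _ => hx) (fun _ => measurable_const)
    (fun _ => hy₀) measurable_const
  exact ⟨_, hy ()⟩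

namespace IsReflectedPath

lemma nonneg (h : IsReflectedPath R a b x y) {t : ℝ} (ht : t ∈ Icc a b) : 0 ≤ y t := by
  obtain ⟨L, hL⟩ := h
  exact fun i => hL.nonneg t ht i

lemma congr (h : IsReflectedPath R a b x y) {x' y' : ℝ → Fin d → ℝ} (hx : EqOn x x' (Icc a b))
    (hy : EqOn y y' (Icc a b)) (hab : a ≤ b) : IsReflectedPath R a b x' y' := by
  obtain ⟨L, hL⟩ := h
  have ha := left_mem_Icc.2 hab
  refine ⟨L, hL.continuousOn.congr hy.symm, fun t ht => ?_, fun t ht i => ?_, hL.pushing_zero,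
    fun i => ?_⟩
  · rw [← hy ht, ← hy ha, ← hx ht, ← hx ha, hL.equation t ht]
  · rw [← hy ht]
    exact hL.nonneg t ht i
  · rw [← hL.complementarity i]
    refine setLIntegral_congr_fun measurableSet_Ioc fun t ht => ?_
    simp only [hy (Ioc_subset_Icc_self ht)]

lemma mono_left (h : IsReflectedPath R a b x y) {c : ℝ} (hac : a ≤ c) (hcb : c ≤ b) :
    IsReflectedPath R c b x y := by
  obtain ⟨L, hL⟩ := h
  have hsub : Icc c b ⊆ Icc a b := Icc_subset_Icc_left hac
  -- Restarting at `c` replaces `L` by `L - L(c)`, which has the same Stieltjes measure.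
  have hmeas : ∀ i, (L i + StieltjesFunction.const ℝ (-L i c)).measure = (L i).measure := by
    intro i
    rw [StieltjesFunction.measure_add, StieltjesFunction.measure_const, add_zero]
  refine ⟨fun i => L i + StieltjesFunction.const ℝ (-L i c), hL.continuousOn.mono hsub,
    fun t ht => ?_, fun t ht => hL.nonneg t (hsub ht), fun i => ?_, fun i => ?_⟩
  · have h1 : (fun i => (L i + StieltjesFunction.const ℝ (-L i c)) t) =
        (fun i => L i t) - fun i => L i c := by
      ext i
      simp [sub_eq_add_neg]
    rw [h1, Matrix.mulVec_sub, hL.equation t (hsub ht), hL.equation c (hsub (left_mem_Icc.2 hcb))]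
    abel
  · simp
  · rw [hmeas]
    refine le_antisymm (le_trans ?_ (hL.complementarity i).le) zero_le
    exact lintegral_mono_set (Ioc_subset_Ioc_left hac)

/-- Translation passes through the regulator equation, so no Stieltjes measure has to be
transported. -/
lemma comp_sub (h : IsReflectedPath R a b x y) (hR : IsMMatrix R) (hab : a ≤ b)
    (hx : Continuous x) (r : ℝ) :
    IsReflectedPath R (a + r) (b + r) (fun t => x (t - r)) (fun t => y (t - r)) := by
  have h0 : 0 ≤ y a := h.nonneg (left_mem_Icc.2 hab)
  obtain ⟨L, hL⟩ := h
  have hreg := (hL.isRegulator hR hx.continuousOn).comp_sub r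
  have hu := IsRegulator.isUniqueReflectedPath hR (a := a + r) (b := b + r) (by linarith)
    (x := fun t => x (t - r)) (by fun_prop) h0 (by simpa using hreg)
  refine hu.1.congr (fun _ _ => rfl) (fun t ht => ?_) (by linarith)
  simp only [add_sub_cancel_right]
  rw [hL.equation (t - r) ⟨by linarith [ht.1], by linarith [ht.2]⟩]

lemma mono_right (h : IsReflectedPath R a b x y) {c : ℝ} (hcb : c ≤ b) :
    IsReflectedPath R a c x y := by
  obtain ⟨L, hL⟩ := h
  have hsub : Icc a c ⊆ Icc a b := Icc_subset_Icc_right hcb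
  refine ⟨L, hL.continuousOn.mono hsub, fun t ht => hL.equation t (hsub ht),
    fun t ht => hL.nonneg t (hsub ht), hL.pushing_zero, fun i => ?_⟩
  refine le_antisymm (le_trans ?_ (hL.complementarity i).le) zero_le
  exact lintegral_mono_set (Ioc_subset_Ioc_right hcb)

/-- Minimality of reflected paths in the order induced by `R⁻¹`. -/
theorem inv_mulVec_le (h : IsReflectedPath R a b x y) (hR : IsMMatrix R) (hx : Continuous x)
    {u : ℝ → Fin d → ℝ} (hu : ∀ t ∈ Icc a b, 0 ≤ u t)
    (hmono : ∀ s ∈ Icc a b, ∀ t ∈ Icc a b, s ≤ t → R⁻¹ *ᵥ (u s - x s) ≤ R⁻¹ *ᵥ (u t - x t))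
    (h0 : R⁻¹ *ᵥ y a ≤ R⁻¹ *ᵥ u a) {t : ℝ} (ht : t ∈ Icc a b) :
    R⁻¹ *ᵥ y t ≤ R⁻¹ *ᵥ u t := by
  obtain ⟨L, hL⟩ := h
  have ha : a ∈ Icc a b := left_mem_Icc.2 (ht.1.trans ht.2)
  have hreg := hL.isRegulator hR hx.continuousOn
  -- This `U` is the pushing that would turn the free path into `u`: `y a + (x - x a) + R U = u ≥
  -- 0`, and `U a = R⁻¹(u a - y a) ≥ 0`.
  have hle := hreg.le_of_nonneg hR (U := fun t => R⁻¹ *ᵥ (u t - x t) + R⁻¹ *ᵥ (x a - y a))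
    (fun i s hs t ht hst => by simpa using hmono s hs t ht hst i) (fun t ht i => ?_)
    (fun t ht i => ?_) t ht
  · rw [hL.equation t ht, Matrix.mulVec_add, hR.inv_mulVec_mulVec]
    refine (add_le_add_right hle _).trans_eq ?_
    simp only [← Matrix.mulVec_add]
    congr 1
    abel
  · have h1 := hmono a ha t ht ht.1 i
    have h2 := h0 i
    simp only [Matrix.mulVec_sub, Pi.add_apply, Pi.sub_apply] at h1 ⊢
    linarith
  · have h1 := hu t ht i
    simp only [Matrix.mulVec_add, hR.mulVec_inv_mulVec, Pi.add_apply, Pi.sub_apply,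
      Pi.zero_apply] at h1 ⊢
    linarith

lemma inv_mulVec_sub_mono (h : IsReflectedPath R a b x y) (hR : IsMMatrix R) {s t : ℝ}
    (hs : s ∈ Icc a b) (ht : t ∈ Icc a b) (hst : s ≤ t) :
    R⁻¹ *ᵥ (y s - x s) ≤ R⁻¹ *ᵥ (y t - x t) := by
  obtain ⟨L, hL⟩ := h
  have key : ∀ t ∈ Icc a b, R⁻¹ *ᵥ (y t - x t) = R⁻¹ *ᵥ (y a - x a) + fun i => L i t := by
    intro t ht
    conv_rhs => rw [← hR.inv_mulVec_mulVec (fun i => L i t), ← Matrix.mulVec_add]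
    rw [hL.equation t ht]
    congr 1
    abel
  rw [key s hs, key t ht]
  exact add_le_add_right (fun i => (L i).mono hst) _

/-- Reflected paths with the same input are Lipschitz in their initial value. -/
theorem inv_mulVec_le_add (h : IsReflectedPath R a b x y) (hR : IsMMatrix R) (hx : Continuous x)
    {y' : ℝ → Fin d → ℝ} (h' : IsReflectedPath R a b x y') {t : ℝ} (ht : t ∈ Icc a b) :
    R⁻¹ *ᵥ y t ≤ R⁻¹ *ᵥ y' t + ‖y a - y' a‖ • (R⁻¹ *ᵥ 1) := by
  have hn : (0 : Fin d → ℝ) ≤ ‖y a - y' a‖ • 1 := smul_nonneg (norm_nonneg _) zero_le_one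
  rw [← Matrix.mulVec_smul, ← Matrix.mulVec_add]
  -- Raising `y'` by a constant puts it above `y` at time `a` without affecting the monotonicity of
  -- `R⁻¹(y' - x)`.
  refine h.inv_mulVec_le hR hx (u := fun t => y' t + ‖y a - y' a‖ • 1)
    (fun t ht => add_nonneg (h'.nonneg ht) hn) (fun s hs t ht hst => ?_)
    (mulVec_mono hR.inv_nonneg fun i => ?_) ht
  · have h1 := add_le_add_left (h'.inv_mulVec_sub_mono hR hs ht hst)
      (R⁻¹ *ᵥ (‖y a - y' a‖ • 1))
    simp only [← Matrix.mulVec_add] at h1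
    convert h1 using 2 <;> abel
  · have h1 := (Real.le_norm_self _).trans (norm_le_pi_norm (y a - y' a) i)
    simp only [Pi.add_apply, Pi.smul_apply, Pi.one_apply, smul_eq_mul, mul_one]
    simp only [Pi.sub_apply] at h1
    linarith

/-- The Lipschitz bound, used in both directions, squeezes `R⁻¹ Y_n(t)`; applying `R` gives the
claim. -/
theorem tendsto_of_tendsto_left {ι : Type*} {l : Filter ι} {Y : ι → ℝ → Fin d → ℝ}
    (hY : ∀ᶠ n in l, IsReflectedPath R a b x (Y n)) (h : IsReflectedPath R a b x y)
    (hR : IsMMatrix R) (hx : Continuous x) (ha : Tendsto (fun n => Y n a) l (𝓝 (y a)))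
    {t : ℝ} (ht : t ∈ Icc a b) : Tendsto (fun n => Y n t) l (𝓝 (y t)) := by
  have hn : Tendsto (fun n => ‖Y n a - y a‖) l (𝓝 0) := tendsto_iff_norm_sub_tendsto_zero.1 ha
  have key : Tendsto (fun n => R⁻¹ *ᵥ Y n t) l (𝓝 (R⁻¹ *ᵥ y t)) := by
    refine tendsto_pi_nhds.2 fun i => ?_
    have hc : Tendsto (fun n => ‖Y n a - y a‖ * (R⁻¹ *ᵥ 1) i) l (𝓝 0) := by
      simpa using hn.mul_const ((R⁻¹ *ᵥ 1) i)
    refine tendsto_of_tendsto_of_tendsto_of_le_of_le' (g := fun n => (R⁻¹ *ᵥ y t) i -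
      ‖Y n a - y a‖ * (R⁻¹ *ᵥ 1) i) (h := fun n => (R⁻¹ *ᵥ y t) i +
      ‖Y n a - y a‖ * (R⁻¹ *ᵥ 1) i) (by simpa using hc.const_sub ((R⁻¹ *ᵥ y t) i))
      (by simpa using hc.const_add ((R⁻¹ *ᵥ y t) i)) ?_ ?_
    · filter_upwards [hY] with n hYn
      have h1 := h.inv_mulVec_le_add hR hx hYn ht i
      rw [norm_sub_rev] at h1
      simp only [Pi.add_apply, Pi.smul_apply, smul_eq_mul] at h1
      linarith
    · filter_upwards [hY] with n hYn
      exact hYn.inv_mulVec_le_add hR hx h ht i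
  have hcont : Continuous fun v : Fin d → ℝ => R *ᵥ v :=
    continuous_const.matrix_mulVec continuous_id
  simpa only [Function.comp_def, hR.mulVec_inv_mulVec] using (hcont.tendsto _).comp key

end IsReflectedPath

end ReflectedPaths

/-! ### The dominating path and orthogonal reflection. -/

section PastSupremum

variable {d : ℕ} {ζ : ℝ → Fin d → ℝ}

/-- The path `s ↦ sup_{r ≤ s} (ζ(s) - ζ(r))`, coordinate by coordinate. -/
noncomputable def pastSup (ζ : ℝ → Fin d → ℝ) (s : ℝ) : Fin d → ℝ :=
  fun i => ⨆ r : Iic s, (ζ s i - ζ r i)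

lemma bddAbove_past (hb : ∀ i, BddBelow (range fun t => ζ t i)) (s : ℝ) (i : Fin d) :
    BddAbove (range fun r : Iic s => ζ s i - ζ r i) := by
  obtain ⟨C, hC⟩ := hb i
  refine ⟨ζ s i - C, ?_⟩
  rintro _ ⟨r, rfl⟩
  have : C ≤ ζ r i := hC ⟨r, rfl⟩
  simp only
  linarith

lemma sub_le_pastSup (hb : ∀ i, BddBelow (range fun t => ζ t i)) {r s : ℝ} (hrs : r ≤ s)
    (i : Fin d) : ζ s i - ζ r i ≤ pastSup ζ s i :=
  le_ciSup (bddAbove_past hb s i) (⟨r, hrs⟩ : Iic s)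

lemma pastSup_nonneg (hb : ∀ i, BddBelow (range fun t => ζ t i)) (s : ℝ) : 0 ≤ pastSup ζ s :=
  fun i => by simpa using sub_le_pastSup hb le_rfl i

lemma pastSup_le {s c : ℝ} {i : Fin d} (h : ∀ r ≤ s, ζ s i - ζ r i ≤ c) : pastSup ζ s i ≤ c :=
  ciSup_le fun r => h r r.2

/-- The difference `pastSup ζ s - ζ s` is minus the infimum of `ζ` over `(-∞, s]`. -/
lemma sub_mono_pastSup (hb : ∀ i, BddBelow (range fun t => ζ t i)) {s t : ℝ} (hst : s ≤ t) :
    pastSup ζ s - ζ s ≤ pastSup ζ t - ζ t := by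
  intro i
  have : pastSup ζ s i ≤ pastSup ζ t i - ζ t i + ζ s i := pastSup_le fun r hr => by
    have := sub_le_pastSup hb (hr.trans hst) i
    linarith
  simp only [Pi.sub_apply]
  linarith

lemma pastSup_eq_of_shift {ζ' : ℝ → Fin d → ℝ} {t h : ℝ} {k : Fin d → ℝ}
    (hζ : ∀ r ≤ t, ζ' r = ζ (r - h) + k) : pastSup ζ' t = pastSup ζ (t - h) := by
  ext i
  refine Equiv.iSup_congr (⟨fun r => ⟨r - h, by have := r.2; simp only [mem_Iic] at *; linarith⟩,
    fun r => ⟨r + h, by have := r.2; simp only [mem_Iic] at *; linarith⟩,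
    fun r => by simp, fun r => by simp⟩ : Iic t ≃ Iic (t - h)) fun r => ?_
  simp [hζ t le_rfl, hζ r r.2]

lemma measurable_pastSup {E : Type*} [MeasurableSpace E] {ζ : E → ℝ → Fin d → ℝ}
    (hc : ∀ e, Continuous (ζ e)) (hb : ∀ e i, BddBelow (range fun t => ζ e t i))
    (hm : ∀ t, Measurable fun e => ζ e t) (t : ℝ) : Measurable fun e => pastSup (ζ e) t := by
  refine measurable_pi_lambda _ fun i => measurable_iSup_of_continuous
    (f := fun e (r : Iic t) => ζ e t i - ζ e r i) (fun e => ?_) (fun r => ?_)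
    (fun e => bddAbove_past (hb e) t i)
  · have := continuous_pi_iff.1 (hc e) i
    exact continuous_const.sub (this.comp continuous_subtype_val)
  · exact ((measurable_pi_apply i).comp (hm t)).sub ((measurable_pi_apply i).comp (hm r))

/-- For `R = 1` the equation decouples and its integrand `(-ξ)⁺` is explicit. Splitting the supremum
at `a`, the times `r ≤ a` are covered by the value `0` of the positive part and the times `r > a` by
`-ξ(r)`. -/
lemma isRegulator_pastSup (hc : Continuous ζ) (hb : ∀ i, BddBelow (range fun t => ζ t i))
    (a b : ℝ) : IsRegulator 1 a b (fun t => pastSup ζ a + (ζ t - ζ a))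
      (fun t => pastSup ζ t - (pastSup ζ a + (ζ t - ζ a))) := by
  have hg : ∀ i, Continuous fun s => max 0 (-(pastSup ζ a i + (ζ s i - ζ a i))) := by
    intro i
    have := continuous_pi_iff.1 hc i
    fun_prop
  have key : ∀ t ∈ Icc a b, ∀ i, pastSup ζ t i - (pastSup ζ a i + (ζ t i - ζ a i)) =
      runMax a (fun s => max 0 (-(pastSup ζ a i + (ζ s i - ζ a i)))) t := by
    intro t ht i
    refine le_antisymm ?_ (runMax_le ht.1 fun s hs => max_le ?_ ?_)
    · rw [sub_le_iff_le_add]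
      refine pastSup_le fun r hr => ?_
      rcases le_or_gt r a with hra | hra
      · have h1 := sub_le_pastSup hb hra i
        have h2 := (le_max_left _ _).trans (le_runMax ht.1 (hg i).continuousOn (left_mem_Icc.2 ht.1))
        linarith
      · have h2 := (le_max_right _ _).trans
          (le_runMax ht.1 (hg i).continuousOn ⟨hra.le, hr⟩)
        linarith
    · have := sub_mono_pastSup hb ht.1 i
      simp only [Pi.sub_apply] at this
      linarith
    · have := sub_le_pastSup hb hs.2 i
      linarith
  refine ⟨?_, fun t ht i => ?_⟩
  · refine continuousOn_pi.2 fun i => ?_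
    exact (continuous_runMax (hg i)).continuousOn.congr fun t ht => key t ht i
  · simp only [Pi.sub_apply, Pi.add_apply]
    rw [key t ht i]
    refine runMax_congr ht.1 fun s _ => ?_
    simp only [Matrix.one_mulVec, Pi.sub_apply, Pi.add_apply]
    congr 1
    ring

lemma isReflectedPath_pastSup (hc : Continuous ζ) (hb : ∀ i, BddBelow (range fun t => ζ t i))
    {a b : ℝ} (hab : a ≤ b) : IsReflectedPath 1 a b ζ (pastSup ζ) := by
  refine ((isRegulator_pastSup hc hb a b).isUniqueReflectedPath IsMMatrix.one hab hc
    (pastSup_nonneg hb a)).1.congr (fun _ _ => rfl) (fun t _ => ?_) hab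
  simp

/-- Comparison bounds `Y_T(t)` above by the past supremum. Monotonicity of `Y_T - ζ` with `Y_T ≥ 0`
bounds it below by `ζ(t) - ζ(r)` for every `r ∈ [T, t]`. -/
lemma tendsto_pastSup (hc : Continuous ζ) (hb : ∀ i, BddBelow (range fun t => ζ t i)) {b : ℝ}
    {Y : ℝ → ℝ → Fin d → ℝ} (hY : ∀ T ≤ b, IsReflectedPath 1 T b ζ (Y T)) (h0 : ∀ T ≤ b, Y T T = 0)
    {t : ℝ} (ht : t ≤ b) : Tendsto (fun T => Y T t) atBot (𝓝 (pastSup ζ t)) := by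
  refine tendsto_pi_nhds.2 fun i => ?_
  have hle : ∀ T ≤ t, Y T t i ≤ pastSup ζ t i := by
    intro T hT
    have := (hY T (hT.trans ht)).inv_mulVec_le IsMMatrix.one hc (u := pastSup ζ)
      (fun s _ => pastSup_nonneg hb s) (fun r _ s _ hrs => by
        simpa using sub_mono_pastSup hb hrs)
      (by simpa [h0 T (hT.trans ht)] using pastSup_nonneg hb T) ⟨hT, ht⟩ i
    simpa using this
  have hge : ∀ T ≤ t, ∀ r ∈ Icc T t, ζ t i - ζ r i ≤ Y T t i := by
    intro T hT r hr
    have h1 := (hY T (hT.trans ht)).inv_mulVec_sub_mono IsMMatrix.one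
      ⟨hr.1, hr.2.trans ht⟩ ⟨hT, ht⟩ hr.2 i
    have h2 := (hY T (hT.trans ht)).nonneg ⟨hr.1, hr.2.trans ht⟩ i
    simp only [inv_one, Matrix.one_mulVec, Pi.sub_apply, Pi.zero_apply] at h1 h2
    linarith
  refine tendsto_order.2 ⟨fun c hct => ?_, fun c hct => ?_⟩
  · obtain ⟨r, hr⟩ := (lt_ciSup_iff (bddAbove_past hb t i)).1 hct
    filter_upwards [eventually_le_atBot (r : ℝ)] with T hT
    exact hr.trans_le (hge T (hT.trans r.2) r ⟨hT, r.2⟩)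
  · filter_upwards [eventually_le_atBot t] with T hT
    exact (hle T hT).trans_lt hct

end PastSupremum

/-! ### Coupling from the past, path by path. -/

section Coupling

variable {d : ℕ} {R : Matrix (Fin d) (Fin d) ℝ} {x ζ : ℝ → Fin d → ℝ} {z : Fin d → ℝ}
  {Y : ℝ → ℝ → Fin d → ℝ}

/-- A path reflected according to `R` stays below the dominating path, in the order induced
by `R⁻¹`. -/
lemma IsReflectedPath.inv_mulVec_le_pastSup (hR : IsMMatrix R) (hz : R⁻¹ *ᵥ z ≤ 0)
    (hx : Continuous x) (hb : ∀ i, BddBelow (range fun t => ζ t i)) {a b : ℝ}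
    (hζ : ∀ t ≤ b, ζ t = x t - t • z) {y : ℝ → Fin d → ℝ} (h : IsReflectedPath R a b x y)
    (h0 : R⁻¹ *ᵥ y a ≤ R⁻¹ *ᵥ pastSup ζ a) {t : ℝ} (ht : t ∈ Icc a b) :
    R⁻¹ *ᵥ y t ≤ R⁻¹ *ᵥ pastSup ζ t := by
  refine h.inv_mulVec_le hR hx (fun s _ => pastSup_nonneg hb s) (fun r hr s hs hrs => ?_) h0 ht
  -- With `x = ζ + t z`, the increment of `R⁻¹(pastSup ζ - x)` is that of `R⁻¹(pastSup ζ - ζ)` plus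
  -- `-(s - r) R⁻¹ z ≥ 0`.
  have h1 := mulVec_mono hR.inv_nonneg (sub_mono_pastSup hb hrs)
  intro i
  have h2 := h1 i
  have h3 := mul_nonneg (sub_nonneg.2 hrs) (neg_nonneg.2 (hz i))
  rw [hζ r hr.2, hζ s hs.2] at h2
  simp only [Matrix.mulVec_sub, Matrix.mulVec_smul, Pi.sub_apply, Pi.smul_apply, smul_eq_mul]
    at h2 h3 ⊢
  linarith

/-- At time `T` the older path `Y S` lies below the dominating path, which is where `Y T` starts;
from then on `Y T` itself is the competitor for `Y S`. -/
lemma inv_mulVec_antitone_start (hR : IsMMatrix R) (hz : R⁻¹ *ᵥ z ≤ 0) (hx : Continuous x)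
    (hb : ∀ i, BddBelow (range fun t => ζ t i)) {b : ℝ} (hζ : ∀ t ≤ b, ζ t = x t - t • z)
    (hY : ∀ T ≤ b, IsReflectedPath R T b x (Y T)) (h0 : ∀ T ≤ b, Y T T = pastSup ζ T)
    {S T t : ℝ} (hST : S ≤ T) (hTt : T ≤ t) (ht : t ≤ b) :
    R⁻¹ *ᵥ Y S t ≤ R⁻¹ *ᵥ Y T t := by
  have hTb := hTt.trans ht
  have hSb := hST.trans hTb
  refine ((hY S hSb).mono_left hST hTb).inv_mulVec_le hR hx
    (fun s hs => (hY T hTb).nonneg hs)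
    (fun r hr s hs hrs => (hY T hTb).inv_mulVec_sub_mono hR hr hs hrs) ?_ ⟨hTt, ht⟩
  rw [h0 T hTb]
  exact (hY S hSb).inv_mulVec_le_pastSup hR hz hx hb hζ (by rw [h0 S hSb]) ⟨hST, hTb⟩

lemma exists_tendsto_start (hR : IsMMatrix R) (hz : R⁻¹ *ᵥ z ≤ 0) (hx : Continuous x)
    (hb : ∀ i, BddBelow (range fun t => ζ t i)) {b : ℝ} (hζ : ∀ t ≤ b, ζ t = x t - t • z)
    (hY : ∀ T ≤ b, IsReflectedPath R T b x (Y T)) (h0 : ∀ T ≤ b, Y T T = pastSup ζ T)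
    {t : ℝ} (ht : t ≤ b) :
    ∃ y, Tendsto (fun T => Y T t) atBot (𝓝 y) := by
  have hlim : ∀ i, Tendsto (fun T => (R⁻¹ *ᵥ Y T t) i) atBot
      (𝓝 (⨅ T, (R⁻¹ *ᵥ Y (min T t) t) i)) := by
    intro i
    -- Monotonicity is known only for starting times up to `t`; `min T t` makes the family monotone
    -- in every `T`.
    refine (tendsto_atBot_ciInf (f := fun T => (R⁻¹ *ᵥ Y (min T t) t) i) (fun S T hST => ?_)
      ⟨0, ?_⟩).congr' ?_
    · exact inv_mulVec_antitone_start hR hz hx hb hζ hY h0 (min_le_min_right t hST)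
        (min_le_right _ _) ht i
    · rintro _ ⟨T, rfl⟩
      exact mulVec_nonneg hR.inv_nonneg
        ((hY _ ((min_le_right _ _).trans ht)).nonneg ⟨min_le_right _ _, ht⟩) i
    · filter_upwards [eventually_le_atBot t] with T hT
      rw [min_eq_left hT]
  have hcont : Continuous fun v : Fin d → ℝ => R *ᵥ v :=
    continuous_const.matrix_mulVec continuous_id
  refine ⟨_, ((hcont.tendsto _).comp (tendsto_pi_nhds.2 hlim)).congr fun T => ?_⟩
  simp only [Function.comp_apply, hR.mulVec_inv_mulVec]

/-- The limit over the starting time of the coupled paths is itself a reflected path. -/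
lemma isReflectedPath_limit (hR : IsMMatrix R) (hx : Continuous x) {b : ℝ}
    (hY : ∀ T ≤ b, IsReflectedPath R T b x (Y T)) {y : ℝ → Fin d → ℝ}
    (hy : ∀ t ≤ b, Tendsto (fun T => Y T t) atBot (𝓝 (y t))) {T : ℝ} (hT : T ≤ b) :
    IsReflectedPath R T b x y := by
  have hYT : ∀ᶠ S in atBot, IsReflectedPath R T b x (Y S) := by
    filter_upwards [eventually_le_atBot T] with S hS
    exact (hY S (hS.trans hT)).mono_left hS hT
  have hyT : 0 ≤ y T := by
    refine ge_of_tendsto (hy T hT) ?_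
    filter_upwards [hYT] with S hS
    exact hS.nonneg (left_mem_Icc.2 hT)
  -- The genuine reflected path from `y T` attracts the `Y S`, whose values at `T` tend to `y T`;
  -- hence it equals the limit `y`.
  obtain ⟨y', hy', hy'T, -⟩ := exists_isUniqueReflectedPath hR hT hx hyT
  refine hy'.congr (fun _ _ => rfl) (fun t ht => ?_) hT
  refine tendsto_nhds_unique (hy'.tendsto_of_tendsto_left hYT hR hx ?_ ht) (hy t ht.2)
  rw [hy'T]
  exact hy T hT

lemma inv_mulVec_limit_le (hR : IsMMatrix R) (hz : R⁻¹ *ᵥ z ≤ 0) (hx : Continuous x)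
    (hb : ∀ i, BddBelow (range fun t => ζ t i)) {b : ℝ} (hζ : ∀ t ≤ b, ζ t = x t - t • z)
    (hY : ∀ T ≤ b, IsReflectedPath R T b x (Y T)) (h0 : ∀ T ≤ b, Y T T = pastSup ζ T)
    {y : ℝ → Fin d → ℝ}
    (hy : ∀ t ≤ b, Tendsto (fun T => Y T t) atBot (𝓝 (y t))) {t : ℝ} (ht : t ≤ b) :
    R⁻¹ *ᵥ y t ≤ R⁻¹ *ᵥ pastSup ζ t := by
  have hcont : Continuous fun v : Fin d → ℝ => R⁻¹ *ᵥ v :=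
    continuous_const.matrix_mulVec continuous_id
  refine le_of_tendsto ((hcont.tendsto _).comp (hy t ht)) ?_
  filter_upwards [eventually_le_atBot t] with T hT
  exact (hY T (hT.trans ht)).inv_mulVec_le_pastSup hR hz hx hb hζ
    (by rw [h0 T (hT.trans ht)]) ⟨hT, ht⟩

end Coupling

/-! ### Shift-covariant functionals on path space. -/

section PathSpace

variable {d : ℕ} {z : Fin d → ℝ}

/-- Continuous paths `w` on `[0, ∞)` such that `w(t) - t z` is bounded above. -/
abbrev PathSpace (z : Fin d → ℝ) : Type :=
  {w : ℝ≥0 → Fin d → ℝ // Continuous w ∧ ∀ i, BddAbove (range fun t : ℝ≥0 => w t i - t * z i)}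

/-- The time reversal of the path `t ↦ w(t) - t m`. -/
noncomputable def reversal (m : Fin d → ℝ) (w : ℝ≥0 → Fin d → ℝ) (t : ℝ) : Fin d → ℝ :=
  -(w (Real.toNNReal (-t)) - ((Real.toNNReal (-t) : ℝ≥0) : ℝ) • m)

/-- The increments of a path after time `h`. -/
def PathSpace.shift (h : ℝ≥0) (w : PathSpace z) : PathSpace z where
  val u := w.1 (h + u) - w.1 h
  property := by
    refine ⟨(w.2.1.comp (continuous_const.add continuous_id)).sub continuous_const, fun i => ?_⟩
    obtain ⟨C, hC⟩ := w.2.2 i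
    refine ⟨C + h * z i - w.1 h i, ?_⟩
    rintro _ ⟨t, rfl⟩
    have := hC ⟨h + t, rfl⟩
    simp only [NNReal.coe_add, Pi.sub_apply] at this ⊢
    linarith

lemma measurable_shift (h : ℝ≥0) : Measurable (PathSpace.shift h : PathSpace z → PathSpace z) := by
  refine Measurable.subtype_mk (measurable_pi_lambda _ fun u => ?_)
  exact ((measurable_pi_apply _).comp measurable_subtype_coe).sub
    ((measurable_pi_apply _).comp measurable_subtype_coe)

lemma continuous_reversal (m : Fin d → ℝ) {w : ℝ≥0 → Fin d → ℝ} (hw : Continuous w) :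
    Continuous (reversal m w) := by
  unfold reversal
  have : Continuous fun t : ℝ => Real.toNNReal (-t) := continuous_real_toNNReal.comp continuous_neg
  fun_prop

lemma bddBelow_reversal (w : PathSpace z) (i : Fin d) :
    BddBelow (range fun t => reversal z w.1 t i) := by
  obtain ⟨C, hC⟩ := w.2.2 i
  refine ⟨-C, ?_⟩
  rintro _ ⟨t, rfl⟩
  have := hC ⟨Real.toNNReal (-t), rfl⟩
  simp only [reversal, Pi.neg_apply, Pi.sub_apply, Pi.smul_apply, smul_eq_mul] at this ⊢
  linarith

lemma measurable_reversal (m : Fin d → ℝ) (t : ℝ) :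
    Measurable fun w : PathSpace z => reversal m w.1 t :=
  (((measurable_pi_apply _).comp measurable_subtype_coe).sub measurable_const).neg

/-- A forward shift becomes a translation in reversed time up to an additive constant, which neither
past suprema nor reflected paths see. -/
lemma reversal_shift (m : Fin d → ℝ) (h : ℝ≥0) (w : PathSpace z) {t : ℝ} (ht : t ≤ 0) :
    reversal m (w.shift h).1 t = reversal m w.1 (t - h) + (w.1 h - (h : ℝ) • m) := by
  have h1 : Real.toNNReal (-(t - h)) = h + Real.toNNReal (-t) := by
    rw [neg_sub, sub_eq_add_neg, Real.toNNReal_add h.coe_nonneg (by linarith), Real.toNNReal_coe]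
  simp only [reversal, PathSpace.shift, h1, NNReal.coe_add, add_smul]
  abel

lemma reversal_eq_sub (m : Fin d → ℝ) (w : ℝ≥0 → Fin d → ℝ) {t : ℝ} (ht : t ≤ 0) :
    reversal m w t = reversal 0 w t - t • m := by
  simp only [reversal, Real.coe_toNNReal _ (neg_nonneg.2 ht), smul_zero, sub_zero, neg_smul]
  abel

/-- The dominating path, as a functional on path space. -/
noncomputable def pathSup (w : PathSpace z) : ℝ → Fin d → ℝ := pastSup (reversal z w.1)

lemma measurable_pathSup (t : ℝ) : Measurable fun w : PathSpace z => pathSup w t :=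
  measurable_pastSup (fun w => continuous_reversal z w.2.1) bddBelow_reversal
    (measurable_reversal z) t

lemma pathSup_shift (h : ℝ≥0) (w : PathSpace z) {t : ℝ} (ht : t ≤ 0) :
    pathSup (w.shift h) t = pathSup w (t - h) :=
  pastSup_eq_of_shift fun _ hr => reversal_shift z h w (hr.trans ht)

lemma IsReflectedPath.congr_add_const {R : Matrix (Fin d) (Fin d) ℝ} {a b : ℝ}
    {x y x' : ℝ → Fin d → ℝ} (h : IsReflectedPath R a b x y) {k : Fin d → ℝ}
    (hx : ∀ t ≤ b, x' t = x t + k) (hab : a ≤ b) : IsReflectedPath R a b x' y := by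
  obtain ⟨L, hL⟩ := h
  refine ⟨L, hL.continuousOn, fun t ht => ?_, hL.nonneg, hL.pushing_zero, hL.complementarity⟩
  rw [hx t ht.2, hx a hab, add_sub_add_right_eq_sub]
  exact hL.equation t ht

/-- The coupled reflected paths and their limit, as measurable and shift-covariant functionals on
path space. -/
theorem exists_coupled_functionals {R : Matrix (Fin d) (Fin d) ℝ} (hR : IsMMatrix R)
    (hz : R⁻¹ *ᵥ z ≤ 0) : ∃ (Y : ℝ → PathSpace z → ℝ → Fin d → ℝ) (Ys : PathSpace z → ℝ → Fin d → ℝ),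
      (∀ w, ∀ T ≤ 0, IsUniqueReflectedPath R T 0 (reversal 0 w.1) (pathSup w T) (Y T w)) ∧
      (∀ w, ∀ S T t : ℝ, S ≤ T → T ≤ t → t ≤ 0 → R⁻¹ *ᵥ Y S w t ≤ R⁻¹ *ᵥ Y T w t) ∧
      (∀ w, ∀ t ≤ 0, Tendsto (fun T => Y T w t) atBot (𝓝 (Ys w t))) ∧
      (∀ w, ∀ T ≤ 0, IsReflectedPath R T 0 (reversal 0 w.1) (Ys w)) ∧
      (∀ w, ∀ t ≤ 0, R⁻¹ *ᵥ Ys w t ≤ R⁻¹ *ᵥ pathSup w t) ∧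
      (∀ t ≤ 0, Measurable fun w => Ys w t) ∧
      (∀ (h : ℝ≥0) w, ∀ t ≤ 0, Ys (w.shift h) t = Ys w (t - h)) := by
  have hex : ∀ T : ℝ, ∃ y : PathSpace z → ℝ → Fin d → ℝ, T ≤ 0 →
      (∀ w, IsUniqueReflectedPath R T 0 (reversal 0 w.1) (pathSup w T) (y w)) ∧
        ∀ t, Measurable fun w => y w t := by
    intro T
    by_cases hT : T ≤ 0
    · obtain ⟨y, hy⟩ := exists_isUniqueReflectedPath_measurable hR hT
        (x := fun w : PathSpace z => reversal 0 w.1) (y₀ := fun w => pathSup w T)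
        (fun w => continuous_reversal 0 w.2.1) (measurable_reversal 0)
        (fun w => pastSup_nonneg (bddBelow_reversal w) T) (measurable_pathSup T)
      exact ⟨y, fun _ => hy⟩
    · exact ⟨0, fun h => absurd h hT⟩
  choose Y hY using hex
  have hx : ∀ w : PathSpace z, Continuous (reversal 0 w.1) := fun w => continuous_reversal 0 w.2.1
  have hζ : ∀ w : PathSpace z, ∀ t ≤ 0, reversal z w.1 t = reversal 0 w.1 t - t • z :=
    fun w t ht => reversal_eq_sub z w.1 ht
  have hrefl : ∀ w, ∀ T ≤ 0, IsReflectedPath R T 0 (reversal 0 w.1) (Y T w) :=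
    fun w T hT => ((hY T hT).1 w).1
  have h0 : ∀ w, ∀ T ≤ 0, Y T w T = pastSup (reversal z w.1) T :=
    fun w T hT => ((hY T hT).1 w).2.1
  have hlim : ∀ (w : PathSpace z) (t : ℝ), ∃ y, t ≤ 0 → Tendsto (fun T => Y T w t) atBot (𝓝 y) := by
    intro w t
    by_cases ht : t ≤ 0
    · obtain ⟨y, hy⟩ := exists_tendsto_start hR hz (hx w) (bddBelow_reversal w) (hζ w)
        (hrefl w) (h0 w) ht
      exact ⟨y, fun _ => hy⟩
    · exact ⟨0, fun h => absurd h ht⟩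
  choose Ys hYs using hlim
  refine ⟨Y, Ys, fun w T hT => (hY T hT).1 w, fun w S T t hST hTt ht => ?_, hYs, fun w T hT => ?_,
    fun w t ht => ?_, fun t ht => ?_, fun h w t ht => ?_⟩
  · exact inv_mulVec_antitone_start hR hz (hx w) (bddBelow_reversal w) (hζ w) (hrefl w) (h0 w)
      hST hTt ht
  · exact isReflectedPath_limit hR (hx w) (hrefl w) (hYs w) hT
  · exact inv_mulVec_limit_le hR hz (hx w) (bddBelow_reversal w) (hζ w) (hrefl w) (h0 w) (hYs w) ht
  · have hseq : Tendsto (fun n : ℕ => -(n : ℝ)) atTop atBot :=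
      tendsto_neg_atTop_atBot.comp tendsto_natCast_atTop_atTop
    refine measurable_of_tendsto_metrizable (f := fun (n : ℕ) w => Y (-n) w t)
      (fun n => (hY (-n) (by simp)).2 t) (tendsto_pi_nhds.2 fun w => ?_)
    exact (hYs w t ht).comp hseq
  · have hh : (0 : ℝ) ≤ h := h.2
    have hth : t - h ≤ 0 := by linarith
    have hshift : Tendsto (fun T : ℝ => T - h) atBot atBot :=
      tendsto_atBot_add_const_right _ (-(h : ℝ)) tendsto_id
    -- By uniqueness `Y T (w.shift h) t = Y (T - h) w (t - h)` for each `T ≤ t`; both sides converge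
    -- as `T → -∞`.
    refine tendsto_nhds_unique (hYs (w.shift h) t ht)
      (((hYs w (t - h) hth).comp hshift).congr' ?_)
    filter_upwards [eventually_le_atBot t] with T hT
    have hT0 : T ≤ 0 := hT.trans ht
    have hTh : T - h ≤ 0 := by linarith
    have h1 := (((hrefl w (T - h) hTh).mono_right (c := -h) (by linarith)).comp_sub hR
      (by linarith) (hx w) h).congr_add_const (fun r hr => reversal_shift 0 h w
        (hr.trans (by linarith))) (by linarith)
    rw [sub_add_cancel, neg_add_cancel] at h1
    refine ((hY T hT0).1 (w.shift h)).2.2 _ h1 ?_ ⟨hT, ht⟩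
    rw [pathSup_shift h w hT0]
    exact h0 w (T - h) hTh

end PathSpace

/-! ### From covariant functionals to stationary versions. -/

section Stationarity

variable {d : ℕ} {Ω : Type*} [MeasurableSpace Ω] {z : Fin d → ℝ}

/-- A random path with stationary independent increments, reversible in law on every time
interval. -/
structure IsReversibleLevy (P : Measure Ω) (X : ℝ≥0 → Ω → Fin d → ℝ) : Prop where
  shift : ∀ h, IdentDistrib (fun ω u => X (h + u) ω - X h ω) (fun ω u => X u ω) P P
  indep : ∀ τ, IndepFun (fun ω u => X (τ + u) ω - X τ ω) (fun ω (u : Iic τ) => X u ω) P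
  reverse : ∀ (τ : ℝ≥0) (n : ℕ) (s : Fin n → ℝ≥0), (∀ k, s k ≤ τ) →
    IdentDistrib (fun ω k => X τ ω - X (τ - s k) ω) (fun ω k => X (s k) ω) P P

lemma identDistrib_of_identDistrib_val {E : Type*} [MeasurableSpace E] {p : E → Prop}
    {P : Measure Ω} {f g : Ω → {e // p e}} (hf : Measurable f) (hg : Measurable g)
    (h : IdentDistrib (fun ω => (f ω : E)) (fun ω => (g ω : E)) P P) : IdentDistrib f g P P := by
  refine ⟨hf.aemeasurable, hg.aemeasurable, Measure.ext fun s hs => ?_⟩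
  obtain ⟨t, ht, rfl⟩ := hs
  have := h.measure_mem_eq ht
  rw [Measure.map_apply hf (measurable_subtype_coe ht),
    Measure.map_apply hg (measurable_subtype_coe ht)]
  exact this

lemma indepFun_of_indepFun_val {E F : Type*} [MeasurableSpace E] [MeasurableSpace F]
    {p : E → Prop} {P : Measure Ω} {f : Ω → {e // p e}} {g : Ω → F}
    (h : IndepFun (fun ω => (f ω : E)) g P) : IndepFun f g P := by
  rw [IndepFun_iff_Indep] at h ⊢
  convert h using 1
  exact MeasurableSpace.comap_comp

/-- A shift-covariant functional of a reversible Lévy path yielding reflected paths is a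
stationary version of the reflected process. -/
theorem isStationaryVersion_of_functional {P : Measure Ω} {W : Ω → PathSpace z}
    (hW : Measurable W) (hL : IsReversibleLevy P fun t ω => (W ω).1 t)
    {M : Matrix (Fin d) (Fin d) ℝ} (m : Fin d → ℝ) {F : PathSpace z → ℝ → Fin d → ℝ}
    (hFm : ∀ t ≤ 0, Measurable fun w => F w t)
    (hFs : ∀ (h : ℝ≥0) w, ∀ t ≤ 0, F (w.shift h) t = F w (t - h))
    (hFr : ∀ w, ∀ T ≤ 0, IsReflectedPath M T 0 (reversal m w.1) (F w)) :
    IsStationaryVersion P M (fun t ω => (W ω).1 t - (t : ℝ) • m)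
      (fun t ω => reversal m (W ω).1 t) (fun t ω => F (W ω) t) where
  input_law T hT n s hs := by
    have hle : ∀ k, s k ≤ Real.toNNReal (-T) := fun k =>
      NNReal.le_toNNReal_of_coe_le (by linarith [hs k])
    have hmeas : Measurable fun (f : Fin n → Fin d → ℝ) k => f k - (s k : ℝ) • m := by fun_prop
    -- With `τ = -T`, the reversed increment over `[T, T + s]` is `X(τ) - X(τ - s)`, up to the
    -- drift.
    refine IdentDistrib.trans (IdentDistrib.of_ae_eq ?_ (ae_of_all _ fun ω => ?_))
      ((hL.reverse (Real.toNNReal (-T)) n s hle).comp hmeas)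
    · exact measurable_pi_lambda _ (fun k => ((measurable_reversal m _).comp hW).sub
        ((measurable_reversal m _).comp hW)) |>.aemeasurable
    funext k
    have h1 : Real.toNNReal (-(T + s k)) = Real.toNNReal (-T) - s k := by
      rw [NNReal.sub_def, Real.coe_toNNReal _ (neg_nonneg.2 hT)]
      congr 1
      ring
    simp only [reversal, Function.comp_apply, h1, NNReal.coe_sub (hle k), sub_smul]
    abel
  dynamics := ae_of_all _ fun ω => hFr (W ω)
  nonanticipating T hT n k s t hs ht := by
    have hτ : ((Real.toNNReal (-T) : ℝ≥0) : ℝ) = -T := Real.coe_toNNReal _ (neg_nonneg.2 hT)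
    have hu : ∀ j, Real.toNNReal (-t j) ≤ Real.toNNReal (-T) := fun j =>
      Real.toNNReal_le_toNNReal (neg_le_neg (ht j).1)
    have h1 : IndepFun (fun ω => (W ω).shift (Real.toNNReal (-T)))
        (fun ω (u : Iic (Real.toNNReal (-T))) => (W ω).1 u) P :=
      indepFun_of_indepFun_val (hL.indep _)
    have hst : ∀ i, s i + Real.toNNReal (-T) ≤ 0 := fun i => by
      rw [hτ]
      linarith [hs i]
    have hm1 : Measurable fun (w : PathSpace z) i => F w (s i + Real.toNNReal (-T)) :=
      measurable_pi_lambda _ fun i => hFm _ (hst i)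
    have hm2 : Measurable fun (f : Iic (Real.toNNReal (-T)) → Fin d → ℝ) (j : Fin k) =>
        -(f ⟨Real.toNNReal (-t j), hu j⟩ - ((Real.toNNReal (-t j) : ℝ≥0) : ℝ) • m) -
          -(f ⟨Real.toNNReal (-T), self_mem_Iic⟩ - ((Real.toNNReal (-T) : ℝ≥0) : ℝ) • m) := by
      fun_prop
    -- Covariance shows that the past up to `T` depends only on increments after `-T`.
    have h2 : (fun ω i => F (W ω) (s i)) = (fun w i => F w (s i + Real.toNNReal (-T))) ∘
        fun ω => (W ω).shift (Real.toNNReal (-T)) := by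
      funext ω i
      simp only [Function.comp_apply]
      rw [hFs _ _ _ (hst i), add_sub_cancel_right]
    rw [h2]
    exact h1.comp hm1 hm2
  stationary h hh n t ht := by
    have hm1 : Measurable fun (w : PathSpace z) i => F w (t i) :=
      measurable_pi_lambda _ fun i => hFm _ (ht i)
    have h1 : IdentDistrib W (fun ω => (W ω).shift (Real.toNNReal h)) P P :=
      (identDistrib_of_identDistrib_val ((measurable_shift _).comp hW) hW (hL.shift _)).symm
    have h2 : (fun ω k => F (W ω) (t k - h)) =
        (fun w i => F w (t i)) ∘ fun ω => (W ω).shift (Real.toNNReal h) := by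
      funext ω i
      simp only [Function.comp_apply]
      rw [hFs _ _ _ (ht i), Real.coe_toNNReal h hh]
    rw [h2]
    exact h1.comp hm1

lemma IsStationaryVersion.congr {P : Measure Ω} {M : Matrix (Fin d) (Fin d) ℝ}
    {X X' : ℝ≥0 → Ω → Fin d → ℝ} {x x' Y Y' : ℝ → Ω → Fin d → ℝ}
    (h : IsStationaryVersion P M X x Y) (hX : ∀ᵐ ω ∂P, ∀ t, X t ω = X' t ω)
    (hx : ∀ᵐ ω ∂P, ∀ t, x t ω = x' t ω) (hY : ∀ᵐ ω ∂P, ∀ t, Y t ω = Y' t ω) :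
    IsStationaryVersion P M X' x' Y' where
  input_law T hT n s hs := by
    have h1 := h.input_law T hT n s hs
    have e1 : (fun ω k => x (T + s k) ω - x T ω) =ᵐ[P] fun ω k => x' (T + s k) ω - x' T ω := by
      filter_upwards [hx] with ω hω
      simp only [hω]
    have e2 : (fun ω k => X (s k) ω) =ᵐ[P] fun ω k => X' (s k) ω := by
      filter_upwards [hX] with ω hω
      simp only [hω]
    exact ((IdentDistrib.of_ae_eq h1.aemeasurable_fst e1).symm.trans h1).trans
      (IdentDistrib.of_ae_eq h1.aemeasurable_snd e2)
  dynamics := by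
    filter_upwards [h.dynamics, hx, hY] with ω h1 h2 h3 T hT
    exact (h1 T hT).congr (fun t _ => h2 t) (fun t _ => h3 t) hT
  nonanticipating T hT n m s t hs ht := by
    refine (h.nonanticipating T hT n m s t hs ht).congr ?_ ?_
    · filter_upwards [hY] with ω hω
      simp only [hω]
    · filter_upwards [hx] with ω hω
      simp only [hω]
  stationary r hr n t ht := by
    have h1 := h.stationary r hr n t ht
    have e1 : ∀ t : Fin n → ℝ, (fun ω k => Y (t k) ω) =ᵐ[P] fun ω k => Y' (t k) ω := fun t => by
      filter_upwards [hY] with ω hω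
      simp only [hω]
    exact ((IdentDistrib.of_ae_eq h1.aemeasurable_fst (e1 t)).symm.trans h1).trans
      (IdentDistrib.of_ae_eq h1.aemeasurable_snd (e1 _))

end Stationarity

/-! ### Brownian paths: growth, regular versions, reversal, independence. -/

section BrownianPaths

variable {Ω : Type*} [MeasurableSpace Ω] {P : Measure Ω}

lemma identDistrib_of_isPreBrownianReal {B C : ℝ≥0 → Ω → ℝ} (hB : IsPreBrownianReal B P)
    (hC : IsPreBrownianReal C P) {ι : Type*} [Finite ι] (s : ι → ℝ≥0) :
    IdentDistrib (fun ω k => B (s k) ω) (fun ω k => C (s k) ω) P P := by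
  classical
  cases nonempty_fintype ι
  -- The times `s k` may repeat, so the law is read off the finite set of distinct times.
  have hmeas : Measurable fun (f : Finset.univ.image s → ℝ) k =>
      f ⟨s k, Finset.mem_image_of_mem s (Finset.mem_univ k)⟩ := by fun_prop
  exact ((hB.hasLaw (Finset.univ.image s)).identDistrib
    (hC.hasLaw (Finset.univ.image s))).comp hmeas

lemma identDistrib_seq_of_isPreBrownianReal [IsProbabilityMeasure P] {B C : ℝ≥0 → Ω → ℝ}
    (hB : IsPreBrownianReal B P) (hC : IsPreBrownianReal C P) (s : ℕ → ℝ≥0) :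
    IdentDistrib (fun ω k => B (s k) ω) (fun ω k => C (s k) ω) P P :=
  (identDistrib_iff_forall_finset_identDistrib (X := fun k => B (s k)) (Y := fun k => C (s k))
    (aemeasurable_pi_lambda _ fun k => hB.aemeasurable (s k))
    (aemeasurable_pi_lambda _ fun k => hC.aemeasurable (s k))).2 fun I =>
      identDistrib_of_isPreBrownianReal hB hC fun k : I => s k

lemma identDistrib_path_of_isPreBrownianReal [IsProbabilityMeasure P] {B C : ℝ≥0 → Ω → ℝ}
    (hB : IsPreBrownianReal B P) (hC : IsPreBrownianReal C P) (hBm : ∀ t, Measurable (B t))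
    (hCm : ∀ t, Measurable (C t)) :
    IdentDistrib (fun ω t => B t ω) (fun ω t => C t ω) P P :=
  (identDistrib_iff_forall_finset_identDistrib (X := B) (Y := C)
    (measurable_pi_lambda _ hBm).aemeasurable (measurable_pi_lambda _ hCm).aemeasurable).2 fun I =>
      identDistrib_of_isPreBrownianReal hB hC fun k : I => (k : ℝ≥0)

/-- Brownian motion grows sublinearly. -/
theorem ae_abs_le_of_isBrownianReal [IsProbabilityMeasure P] {B : ℝ≥0 → Ω → ℝ}
    (hB : IsBrownianReal B P) :
    ∀ᵐ ω ∂P, ∀ ε > 0, ∃ C, ∀ t : ℝ≥0, |B t ω| ≤ C + ε * t := by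
  let q : ℕ → ℝ≥0 := TopologicalSpace.denseSeq ℝ≥0
  -- A countable, hence measurable, form of convergence to `0` along the times `1 / q k → 0`. It can
  -- thus be transferred in law from `B` to the time inversion `t B(1/t)`.
  let p : (ℕ → ℝ) → Prop := fun f =>
    ∀ n : ℕ, ∃ m : ℕ, ∀ k, 1 / q k < 1 / (m + 1) → |f k| ≤ 1 / ((n : ℝ) + 1)
  have hp : MeasurableSet {f | p f} := by
    simp only [p, ofPred_forall, ofPred_exists]
    refine MeasurableSet.iInter fun n => MeasurableSet.iUnion fun m => MeasurableSet.iInter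
      fun k => MeasurableSet.iInter fun _ => ?_
    exact measurableSet_le (measurable_pi_apply k).abs measurable_const
  have hBp : ∀ᵐ ω ∂P, p fun k => B (1 / q k) ω := by
    filter_upwards [hB.tendsto_nhds_zero] with ω hω n
    have h1 : ∀ᶠ t in 𝓝 (0 : ℝ≥0), |B t ω| ≤ 1 / ((n : ℝ) + 1) := by
      have h2 : Tendsto (fun t => |B t ω|) (𝓝 0) (𝓝 0) := by simpa using hω.abs
      exact (h2.eventually_lt_const (by positivity)).mono fun _ h => h.le
    obtain ⟨r, hr, hr'⟩ := NNReal.nhds_zero_basis.eventually_iff.1 h1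
    obtain ⟨m, hm⟩ := exists_nat_one_div_lt (K := ℝ) (NNReal.coe_pos.2 hr)
    refine ⟨m, fun k hk => hr' (hk.trans ?_)⟩
    exact_mod_cast hm
  have hV : ∀ᵐ ω ∂P, p fun k => (1 / q k : ℝ≥0) * B (1 / (1 / q k)) ω :=
    (identDistrib_seq_of_isPreBrownianReal hB.toIsPreBrownianReal hB.toIsPreBrownianReal.inv
      fun k => 1 / q k).ae_snd hp hBp
  filter_upwards [hB.cont, hV] with ω hc hω ε hε
  obtain ⟨n, hn⟩ := exists_nat_one_div_lt hε
  obtain ⟨m, hm⟩ := hω n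
  have hseq : ∀ k, (m + 1 : ℝ≥0) < q k → |B (q k) ω| ≤ ε * q k := by
    intro k hk
    have hq : 0 < q k := lt_of_le_of_lt zero_le hk
    have h1 : |((1 / q k : ℝ≥0) : ℝ) * B (1 / (1 / q k)) ω| ≤ _ :=
      hm k (one_div_lt_one_div_of_lt (by positivity) hk)
    rw [one_div_one_div, abs_mul, NNReal.coe_div, NNReal.coe_one,
      abs_of_nonneg (by positivity), one_div_mul_eq_div, div_le_iff₀ (by exact_mod_cast hq)] at h1
    exact h1.trans (mul_le_mul_of_nonneg_right hn.le (by positivity))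
  obtain ⟨C, hC⟩ := (isCompact_Icc (a := (0 : ℝ≥0)) (b := m + 1)).exists_bound_of_continuousOn
    hc.continuousOn
  have hC0 : 0 ≤ C := (norm_nonneg _).trans (hC 0 ⟨le_rfl, zero_le⟩)
  refine ⟨C, fun t => ?_⟩
  rcases le_or_gt t (m + 1) with ht | ht
  · have := hC t ⟨zero_le, ht⟩
    rw [Real.norm_eq_abs] at this
    have : 0 ≤ ε * t := by positivity
    linarith
  · suffices |B t ω| ≤ ε * t by linarith
    by_contra! hlt
    -- A violation at `t` would persist on an open set and so occur at some dense time `q k`.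
    have hopen : IsOpen {u : ℝ≥0 | ((m + 1 : ℝ≥0) : ℝ≥0) < u ∧ ε * u < |B u ω|} :=
      (isOpen_lt continuous_const continuous_id).inter (isOpen_lt
        (continuous_const.mul NNReal.continuous_coe) hc.abs)
    obtain ⟨k, hk⟩ := (TopologicalSpace.denseRange_denseSeq ℝ≥0).exists_mem_open hopen ⟨t, ht, hlt⟩
    exact absurd (hseq k hk.1) (not_le.2 hk.2)

/-- A Brownian motion is indistinguishable from a process with measurable coordinates all of whose
paths are continuous and grow sublinearly. -/
theorem exists_regular_version [IsProbabilityMeasure P] {B : ℝ≥0 → Ω → ℝ}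
    (hB : IsBrownianReal B P) :
    ∃ C : ℝ≥0 → Ω → ℝ, (∀ t, Measurable (C t)) ∧ (∀ ω, Continuous fun t => C t ω) ∧
      (∀ ω, ∀ ε > 0, ∃ K, ∀ t : ℝ≥0, |C t ω| ≤ K + ε * t) ∧ ∀ᵐ ω ∂P, ∀ t, B t ω = C t ω := by
  let q : ℕ → ℝ≥0 := TopologicalSpace.denseSeq ℝ≥0
  have hmk : ∀ᵐ ω ∂P, ∀ k, B (q k) ω = (hB.aemeasurable (q k)).mk _ ω :=
    ae_all_iff.2 fun k => (hB.aemeasurable (q k)).ae_eq_mk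
  -- Off the measurable full-measure set `G` the version is put equal to `0`. On `G` it agrees with
  -- measurable functions at dense times, and continuity extends measurability to every time.
  obtain ⟨G, hG, hGm, hGp⟩ := ((hB.cont.and (ae_abs_le_of_isBrownianReal hB)).and
    hmk).exists_measurable_mem
  have hc : ∀ ω, Continuous fun t => G.indicator (B t) ω := by
    intro ω
    by_cases hω : ω ∈ G
    · simpa only [indicator_of_mem hω] using (hGp ω hω).1.1
    · simpa only [indicator_of_notMem hω] using continuous_const
  refine ⟨fun t => G.indicator (B t), fun t => ?_, hc, fun ω ε hε => ?_, ?_⟩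
  · obtain ⟨r, hr, hrt⟩ := mem_closure_iff_seq_limit.1
      (TopologicalSpace.denseRange_denseSeq ℝ≥0 t)
    choose k hk using hr
    refine measurable_of_tendsto_metrizable
      (f := fun n => G.indicator ((hB.aemeasurable (q (k n))).mk _))
      (fun n => (hB.aemeasurable _).measurable_mk.indicator hGm) (tendsto_pi_nhds.2 fun ω => ?_)
    refine (((hc ω).tendsto t).comp hrt).congr fun n => ?_
    simp only [Function.comp_apply]
    by_cases hω : ω ∈ G
    · rw [indicator_of_mem hω, indicator_of_mem hω, ← hk n]
      exact (hGp ω hω).2 (k n)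
    · rw [indicator_of_notMem hω, indicator_of_notMem hω]
  · by_cases hω : ω ∈ G
    · simpa only [indicator_of_mem hω] using (hGp ω hω).1.2 ε hε
    · refine ⟨0, fun t => ?_⟩
      simp only [indicator_of_notMem hω, abs_zero, zero_add]
      positivity
  · filter_upwards [hG] with ω hω t
    rw [indicator_of_mem hω]

/-- Reversing a Brownian motion on `[0, τ]` gives a Brownian motion. -/
lemma isPreBrownianReal_reverse {B : ℝ≥0 → Ω → ℝ} (hB : IsPreBrownianReal B P) (τ : ℝ≥0) :
    IsPreBrownianReal (fun t ω => B (max t τ) ω - B (τ - t) ω) P := by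
  -- Beyond `τ` the subtraction truncates and the process is `B t - B 0`, so it is defined for all
  -- times. For `s ≤ t` the covariance below is `max s τ - (τ - t) - (τ - s) + (τ - t) = s`.
  have := hB.isGaussianProcess.isProbabilityMeasure
  have hL2 : ∀ t, MemLp (fun ω => B t ω) 2 P := fun t =>
    (hB.isGaussianProcess.hasGaussianLaw_eval t).memLp_two
  refine IsGaussianProcess.isPreBrownianReal_of_covariance ?_ (fun t => ?_) (fun s t hst => ?_)
  · refine hB.isGaussianProcess.of_isGaussianProcess fun t => ⟨{max t τ, τ - t},
      { toFun x := x ⟨max t τ, by simp⟩ - x ⟨τ - t, by simp⟩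
        map_add' x y := by simp; abel
        map_smul' c x := by simp; ring }, by simp⟩
  · rw [integral_sub, hB.integral_eval, hB.integral_eval, sub_zero]
    all_goals exact (hB.isGaussianProcess.hasGaussianLaw_eval _).integrable
  · have hsub : MemLp (fun ω => B (max t τ) ω - B (τ - t) ω) 2 P := (hL2 _).sub (hL2 _)
    rw [covariance_fun_sub_left (hL2 _) (hL2 _) hsub,
      covariance_fun_sub_right (hL2 _) (hL2 _) (hL2 _),
      covariance_fun_sub_right (hL2 _) (hL2 _) (hL2 _),
      hB.covariance_fun_eval, hB.covariance_fun_eval, hB.covariance_fun_eval,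
      hB.covariance_fun_eval]
    have h1 : min (max s τ) (max t τ) = max s τ := min_eq_left (max_le_max_right τ hst)
    have h2 : min (max s τ) (τ - t) = τ - t :=
      min_eq_right (tsub_le_self.trans (le_max_right _ _))
    have h3 : min (τ - s) (max t τ) = τ - s :=
      min_eq_left (tsub_le_self.trans (le_max_right _ _))
    have h4 : min (τ - s) (τ - t) = τ - t := min_eq_right (tsub_le_tsub_left hst τ)
    rw [h1, h2, h3, h4]
    rcases le_total s τ with h | h
    · rw [max_eq_right h, NNReal.coe_sub h]
      ring
    · rw [max_eq_left h, tsub_eq_zero_of_le h]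
      simp

/-- Independence across `j` and within each pair makes the whole family indexed by `κ × Bool`
independent; it is then regrouped by the Boolean. -/
lemma indepFun_pi_of_iIndepFun {κ E : Type*} [Fintype κ] [MeasurableSpace E]
    {f g : κ → Ω → E} (hf : ∀ j, Measurable (f j)) (hg : ∀ j, Measurable (g j))
    (h : iIndepFun (fun j ω => (f j ω, g j ω)) P) (hfg : ∀ j, IndepFun (f j) (g j) P) :
    IndepFun (fun ω j => f j ω) (fun ω j => g j ω) P := by
  classical
  have hprob := h.isProbabilityMeasure
  let X : κ → Bool → Ω → E := fun j b => if b then f j else g j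
  have hX : ∀ j b, Measurable (X j b) := fun j b => by
    cases b
    · exact hg j
    · exact hf j
  have h1 : iIndepFun (fun j ω => (X j · ω)) P := by
    have hm : Measurable fun (e : E × E) (b : Bool) => if b then e.1 else e.2 := by
      refine measurable_pi_lambda _ fun b => ?_
      cases b
      · exact measurable_snd
      · exact measurable_fst
    convert h.comp (fun _ e b => if b then e.1 else e.2) fun _ => hm using 1
    ext j ω b
    cases b <;> rfl
  have h2 : ∀ j, iIndepFun (X j) P := by
    intro j
    rw [iIndepFun_iff_measure_inter_preimage_eq_mul]
    intro S sets hsets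
    have hS : ∀ S : Finset Bool, S = ∅ ∨ S = {true} ∨ S = {false} ∨ S = {true, false} := by
      decide
    obtain rfl | rfl | rfl | rfl := hS S
    · simp
    · simp
    · simp
    · have := (hfg j).measure_inter_preimage_eq_mul _ _ (hsets true (by simp))
        (hsets false (by simp))
      rwa [Finset.set_biInter_insert, Finset.set_biInter_singleton,
        Finset.prod_pair Bool.true_eq_false_eq_False]
  have h3 := (iIndepFun_uncurry' hX h1 h2).indepFun_finset (Finset.univ.image fun j => (j, true))
    (Finset.univ.image fun j => (j, false))
    (Finset.disjoint_left.2 fun a ha hb => by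
      simp only [Finset.mem_image, Finset.mem_univ, true_and] at ha hb
      obtain ⟨_, rfl⟩ := ha
      simp at hb)
    fun p => hX p.1 p.2
  exact h3.comp
    (φ := fun e j => e ⟨(j, true), Finset.mem_image_of_mem _ (Finset.mem_univ j)⟩)
    (ψ := fun e j => e ⟨(j, false), Finset.mem_image_of_mem _ (Finset.mem_univ j)⟩)
    (by fun_prop) (by fun_prop)

end BrownianPaths

/-! ### Drifted Brownian motion as a reversible Lévy path. -/

section DriftedBrownianMotion

lemma bddAbove_driftedBM {d : ℕ} {Ω : Type*} {B : Fin d → ℝ≥0 → Ω → ℝ} {z v : Fin d → ℝ} (hvz : ∀ i, v i < z i)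
    (A : Matrix (Fin d) (Fin d) ℝ) {ω : Ω} (hg : ∀ j, ∀ ε > 0, ∃ K, ∀ t : ℝ≥0, |B j t ω| ≤ K + ε * t) (i : Fin d) :
    BddAbove (range fun t : ℝ≥0 => driftedBM v A B t ω i - t * z i) := by
  have hS : 0 ≤ ∑ j, |A i j| := Finset.sum_nonneg fun j _ => abs_nonneg _
  have hzv : 0 < z i - v i := sub_pos.2 (hvz i)
  -- This rate lets the drift gap `z i - v i` absorb the growth of `(A B) i`; the `+ 1` keeps the
  -- denominator positive.
  choose K hK using fun j => hg j ((z i - v i) / (∑ j, |A i j| + 1)) (by positivity)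
  refine ⟨∑ j, |A i j| * K j, ?_⟩
  rintro _ ⟨t, rfl⟩
  have h1 : (A *ᵥ fun j => B j t ω) i ≤
      ∑ j, |A i j| * (K j + (z i - v i) / (∑ j, |A i j| + 1) * t) := by
    simp only [Matrix.mulVec, dotProduct]
    refine Finset.sum_le_sum fun j _ => ?_
    refine (le_abs_self _).trans ?_
    rw [abs_mul]
    exact mul_le_mul_of_nonneg_left (hK j t) (abs_nonneg _)
  have h2 : (∑ j, |A i j|) * ((z i - v i) / (∑ j, |A i j| + 1) * t) ≤ (z i - v i) * t := by
    rw [← mul_assoc]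
    refine mul_le_mul_of_nonneg_right ?_ t.2
    rw [mul_div_assoc', div_le_iff₀ (by linarith)]
    nlinarith
  simp only [mul_add, Finset.sum_add_distrib, ← Finset.sum_mul] at h1
  simp only [driftedBM, Pi.add_apply, Pi.smul_apply, smul_eq_mul]
  linarith

variable {d : ℕ} {Ω : Type*} [MeasurableSpace Ω] {P : Measure Ω} {B : Fin d → ℝ≥0 → Ω → ℝ}

lemma measurable_smul_add_mulVec {E : Type*} [MeasurableSpace E] (c : ℝ) (v : Fin d → ℝ)
    (A : Matrix (Fin d) (Fin d) ℝ) {f : E → Fin d → ℝ} (hf : ∀ j, Measurable fun e => f e j) :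
    Measurable fun e => c • v + A *ᵥ f e :=
  measurable_const.add ((continuous_const.matrix_mulVec continuous_id).measurable.comp
    (measurable_pi_lambda _ hf))

lemma isReversibleLevy_driftedBM [IsProbabilityMeasure P] (hBm : ∀ j t, Measurable (B j t))
    (hB : ∀ j, IsPreBrownianReal (B j) P) (hind : iIndepFun (fun j ω t => B j t ω) P)
    (v : Fin d → ℝ) (A : Matrix (Fin d) (Fin d) ℝ) : IsReversibleLevy P (driftedBM v A B) where
  shift h := by
    have h1 : IdentDistrib (fun ω j u => B j (h + u) ω - B j h ω) (fun ω j u => B j u ω) P P :=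
      IdentDistrib.pi (X := fun j ω u => B j (h + u) ω - B j h ω) (Y := fun j ω u => B j u ω)
        (fun j => identDistrib_path_of_isPreBrownianReal ((hB j).shift h) (hB j)
          (fun t => (hBm j _).sub (hBm j _)) (hBm j))
        (hind.comp (fun _ f u => f (h + u) - f h) fun _ => by fun_prop) hind
    have hm : Measurable fun (b : Fin d → ℝ≥0 → ℝ) (u : ℝ≥0) =>
        (u : ℝ) • v + A *ᵥ fun j => b j u :=
      measurable_pi_lambda _ fun u => measurable_smul_add_mulVec _ v A fun j => by fun_prop
    have h2 : (fun ω u => driftedBM v A B (h + u) ω - driftedBM v A B h ω) =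
        (fun (b : Fin d → ℝ≥0 → ℝ) (u : ℝ≥0) => (u : ℝ) • v + A *ᵥ fun j => b j u) ∘
          fun ω j u => B j (h + u) ω - B j h ω := by
      funext ω u
      have h3 : (fun j => B j (h + u) ω - B j h ω) =
          (fun j => B j (h + u) ω) - fun j => B j h ω := rfl
      simp only [driftedBM, Function.comp_apply, h3, Matrix.mulVec_sub, NNReal.coe_add, add_smul]
      abel
    rw [h2]
    exact h1.comp hm
  indep τ := by
    -- The past is encoded as the path stopped at `τ`, so that past and future live in the same
    -- space.
    have hpair : iIndepFun (fun j ω => ((fun u => B j (τ + u) ω - B j τ ω : ℝ≥0 → ℝ),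
        (fun u => B j (min u τ) ω : ℝ≥0 → ℝ))) P :=
      hind.comp (fun _ f => ((fun u => f (τ + u) - f τ : ℝ≥0 → ℝ), fun u => f (min u τ)))
        fun _ => by fun_prop
    have hψ : Measurable fun (f : Iic τ → ℝ) (u : ℝ≥0) => f ⟨min u τ, min_le_right u τ⟩ := by
      fun_prop
    have hfg : ∀ j, IndepFun (fun ω u => B j (τ + u) ω - B j τ ω)
        (fun ω (u : ℝ≥0) => B j (min u τ) ω) P := fun j =>
      ((hB j).indepFun_shift τ).comp measurable_id hψ
    have h1 := indepFun_pi_of_iIndepFun (f := fun j ω u => B j (τ + u) ω - B j τ ω)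
      (g := fun j ω u => B j (min u τ) ω)
      (fun j => measurable_pi_lambda _ fun u => (hBm j (τ + u)).sub (hBm j τ))
      (fun j => measurable_pi_lambda _ fun u => hBm j (min u τ)) hpair hfg
    have hm1 : Measurable fun (b : Fin d → ℝ≥0 → ℝ) (u : ℝ≥0) =>
        (u : ℝ) • v + A *ᵥ fun j => b j u :=
      measurable_pi_lambda _ fun u => measurable_smul_add_mulVec _ v A fun j => by fun_prop
    have hm2 : Measurable fun (b : Fin d → ℝ≥0 → ℝ) (u : Iic τ) =>
        ((u : ℝ≥0) : ℝ) • v + A *ᵥ fun j => b j u :=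
      measurable_pi_lambda _ fun u => measurable_smul_add_mulVec _ v A fun j => by fun_prop
    convert h1.comp hm1 hm2 using 1
    · funext ω u
      have h3 : (fun j => B j (τ + u) ω - B j τ ω) =
          (fun j => B j (τ + u) ω) - fun j => B j τ ω := rfl
      simp only [driftedBM, Function.comp_apply, h3, Matrix.mulVec_sub, NNReal.coe_add, add_smul]
      abel
    · funext ω u
      simp only [driftedBM, Function.comp_apply, min_eq_left (mem_Iic.1 u.2)]
  reverse τ n s hs := by
    have h1 : IdentDistrib (fun ω j t => B j (max t τ) ω - B j (τ - t) ω)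
        (fun ω j t => B j t ω) P P :=
      IdentDistrib.pi (X := fun j ω t => B j (max t τ) ω - B j (τ - t) ω)
        (Y := fun j ω u => B j u ω)
        (fun j => identDistrib_path_of_isPreBrownianReal (isPreBrownianReal_reverse (hB j) τ) (hB j)
          (fun t => (hBm j _).sub (hBm j _)) (hBm j))
        (hind.comp (fun _ f t => f (max t τ) - f (τ - t)) fun _ => by fun_prop) hind
    have hm : Measurable fun (b : Fin d → ℝ≥0 → ℝ) (k : Fin n) =>
        (s k : ℝ) • v + A *ᵥ fun j => b j (s k) :=
      measurable_pi_lambda _ fun k => measurable_smul_add_mulVec _ v A fun j => by fun_prop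
    have h2 : (fun ω k => driftedBM v A B τ ω - driftedBM v A B (τ - s k) ω) =
        (fun (b : Fin d → ℝ≥0 → ℝ) (k : Fin n) => (s k : ℝ) • v + A *ᵥ fun j => b j (s k)) ∘
          fun ω j t => B j (max t τ) ω - B j (τ - t) ω := by
      funext ω k
      have h3 : (fun j => B j τ ω - B j (τ - s k) ω) =
          (fun j => B j τ ω) - fun j => B j (τ - s k) ω := rfl
      simp only [driftedBM, Function.comp_apply, max_eq_right (hs k), h3, Matrix.mulVec_sub,
        NNReal.coe_sub (hs k), sub_smul]
      abel
    rw [h2]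
    exact h1.comp hm

end DriftedBrownianMotion

end ReflectedBM

/-! ### Assembly for the given Brownian motion. -/

open ReflectedBM
theorem lemma2 {d : ℕ} {Ω : Type*} [MeasurableSpace Ω] (P : Measure Ω) [IsProbabilityMeasure P]
    (B : Fin d → ℝ≥0 → Ω → ℝ) (hB : IsStandardBM B P)
    (A R : Matrix (Fin d) (Fin d) ℝ) (hA : (A * Aᵀ).PosDef) (hR : IsMMatrix R)
    (v z : Fin d → ℝ) (hv : ∀ i, (R⁻¹ *ᵥ v) i < 0)
    (hvz : ∀ i, v i < z i) (hz : ∀ i, (R⁻¹ *ᵥ z) i < 0)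
    -- the input process `X`, the input process `Z = X - z t` of the dominating process,
    -- their time reversals, and the dominating process
    (X Z : ℝ≥0 → Ω → Fin d → ℝ) (hX : X = driftedBM v A B)
    (hZ : Z = fun t ω => X t ω - (t : ℝ) • z)
    (Xrev Zrev Yplus : ℝ → Ω → Fin d → ℝ) (hXrev : Xrev = timeReversal X)
    (hZrev : Zrev = timeReversal Z) (hYplus : Yplus = dominatingProcess Zrev) :
    -- `Yplus` is the limit of the orthogonally reflected processes started from `0` at time `T`
    (∃ Y₀ : ℝ → ℝ → Ω → Fin d → ℝ, ∀ᵐ ω ∂P,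
      (∀ T ≤ (0 : ℝ),
        IsUniqueReflectedPath 1 T 0 (fun t => Zrev t ω) 0 (fun t => Y₀ T t ω)) ∧
      (∀ t ≤ (0 : ℝ), Tendsto (fun T => Y₀ T t ω) atBot (𝓝 (Yplus t ω)))) ∧
    -- `Yplus` is a stationary version of the orthogonally reflected process
    IsStationaryVersion P 1 Z Zrev Yplus ∧
    -- the coupled stationary version `Ystar`, the limit of the processes `YT T`
    -- started from `Yplus T` at time `T`
    ∃ (Ystar : ℝ → Ω → Fin d → ℝ) (YT : ℝ → ℝ → Ω → Fin d → ℝ),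
      IsStationaryVersion P R X Xrev Ystar ∧
      (∀ᵐ ω ∂P, ∀ t ≤ (0 : ℝ), ∀ i,
        (R⁻¹ *ᵥ Ystar t ω) i ≤ (R⁻¹ *ᵥ Yplus t ω) i) ∧
      (∀ᵐ ω ∂P,
        (∀ T ≤ (0 : ℝ),
          IsUniqueReflectedPath R T 0 (fun t => Xrev t ω) (Yplus T ω) (fun t => YT T t ω)) ∧
        (∀ S T t : ℝ, S ≤ T → T ≤ t → t ≤ 0 → ∀ i,
          (R⁻¹ *ᵥ YT S t ω) i ≤ (R⁻¹ *ᵥ YT T t ω) i) ∧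
        (∀ t ≤ (0 : ℝ), Tendsto (fun T => YT T t ω) atBot (𝓝 (Ystar t ω)))) := by
  have hz' : R⁻¹ *ᵥ z ≤ 0 := fun i => (hz i).le
  -- Regularity of every path of `C` places `W ω` in path space for all `ω`; the conclusions return
  -- to `B` by almost sure equality.
  choose C hCm hCc hCg hCB using fun i => exists_regular_version (hB.brownian i)
  have hae : ∀ᵐ ω ∂P, ∀ i t, B i t ω = C i t ω := ae_all_iff.2 hCB
  have hpre : ∀ i, IsPreBrownianReal (C i) P := fun i =>
    (hB.brownian i).toIsPreBrownianReal.congr fun t => (hCB i).mono fun _ h => h t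
  have hind : iIndepFun (fun i ω t => C i t ω) P :=
    hB.indep.congr fun i => (hCB i).mono fun _ h => funext h
  have hLevy := isReversibleLevy_driftedBM hCm hpre hind v A
  have hcont : ∀ ω, Continuous fun t => driftedBM v A C t ω := fun ω =>
    (NNReal.continuous_coe.smul continuous_const).add
      (continuous_const.matrix_mulVec (continuous_pi fun j => hCc j ω))
  let W : Ω → PathSpace z := fun ω => ⟨fun t => driftedBM v A C t ω, hcont ω,
    bddAbove_driftedBM hvz A fun j => hCg j ω⟩
  have hW : Measurable W := Measurable.subtype_mk (measurable_pi_lambda _ fun t =>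
    measurable_smul_add_mulVec _ v A fun j => hCm j t)
  have hXW : ∀ᵐ ω ∂P, ∀ t, (W ω).1 t = X t ω := by
    filter_upwards [hae] with ω hω t
    rw [hX]
    simp only [W, driftedBM, hω]
  have hXrevW : ∀ᵐ ω ∂P, ∀ t, reversal 0 (W ω).1 t = Xrev t ω := by
    filter_upwards [hXW] with ω hω t
    simp only [hXrev, timeReversal, reversal, hω, smul_zero, sub_zero]
  have hZW : ∀ᵐ ω ∂P, ∀ t : ℝ≥0, (W ω).1 t - (t : ℝ) • z = Z t ω := by
    filter_upwards [hXW] with ω hω t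
    simp only [hZ, hω]
  have hZrevW : ∀ᵐ ω ∂P, ∀ t, reversal z (W ω).1 t = Zrev t ω := by
    filter_upwards [hZW] with ω hω t
    simp only [hZrev, timeReversal, reversal, hω]
  have hYplusW : ∀ᵐ ω ∂P, ∀ t, pathSup (W ω) t = Yplus t ω := by
    filter_upwards [hZrevW] with ω hω t
    rw [hYplus]
    funext i
    simp only [dominatingProcess, pathSup, pastSup, hω]
  have hfun : ∀ {x x' : ℝ → Fin d → ℝ}, (∀ t, x t = x' t) → x = x' := fun h => funext h
  have hcz : ∀ w : PathSpace z, Continuous (reversal z w.1) := fun w => continuous_reversal z w.2.1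
  refine ⟨?_, ?_, ?_⟩
  · have hex : ∀ (T : ℝ) (ω : Ω), ∃ y, T ≤ 0 →
        IsUniqueReflectedPath 1 T 0 (reversal z (W ω).1) 0 y := fun T ω => by
      by_cases hT : T ≤ 0
      · obtain ⟨y, hy⟩ := exists_isUniqueReflectedPath IsMMatrix.one hT (hcz (W ω)) le_rfl
        exact ⟨y, fun _ => hy⟩
      · exact ⟨0, fun h => absurd h hT⟩
    choose Y₀ hY₀ using hex
    refine ⟨fun T t ω => Y₀ T ω t, ?_⟩
    filter_upwards [hZrevW, hYplusW] with ω h1 h2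
    rw [← hfun h1]
    refine ⟨fun T hT => hY₀ T ω hT, fun t ht => ?_⟩
    rw [← h2]
    exact tendsto_pastSup (hcz (W ω)) (bddBelow_reversal (W ω)) (fun T hT => (hY₀ T ω hT).1)
      (fun T hT => (hY₀ T ω hT).2.1) ht
  · exact (isStationaryVersion_of_functional hW hLevy z (fun t _ => measurable_pathSup t)
      (fun h w t ht => pathSup_shift h w ht) fun w T hT =>
        isReflectedPath_pastSup (hcz w) (bddBelow_reversal w) hT).congr hZW hZrevW hYplusW
  · obtain ⟨Y, Ys, hY, hmono, hlim, hrefl, hle, hmeas, hshift⟩ := exists_coupled_functionals hR hz'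
    refine ⟨fun t ω => Ys (W ω) t, fun T t ω => Y T (W ω) t, ?_, ?_, ?_⟩
    · exact (isStationaryVersion_of_functional hW hLevy 0 hmeas hshift hrefl).congr
        (by simpa using hXW) hXrevW (ae_of_all _ fun _ _ => rfl)
    · filter_upwards [hYplusW] with ω h2 t ht
      rw [← h2]
      exact hle (W ω) t ht
    · filter_upwards [hXrevW, hYplusW] with ω h1 h2
      rw [← hfun h1]
      simp only [← h2]
      exact ⟨hY (W ω), hmono (W ω), hlim (W ω)⟩
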